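/- Let $\lambda_k\ge 0$ ($k\in\mathcal K$, $\mathcal K$ finite) with $\lambda_A:=\sum_k\lambda_k>0$, let $w_k\in[0,1]$, and put $\lambda_I:=\sum_k w_k\lambda_k$. Let $T>0$, $p>0$, $\alpha>2$, $\sigma^2\ge 0$. In the plane, the base stations (BSs) of operator $k\in\mathcal K$ form a homogeneous Poisson point process $\mathcal F_k$ of intensity $\lambda_k$, the $\mathcal F_k$ are independent, and $\mathcal F=\bigcup_k\mathcal F_k$. A typical user at the origin is served by the nearest BS of $\mathcal F$, called BS-$0$. Every BS $i$ lies at distance $r_i$ from the origin and transmits with power $p$; if $i\in\mathcal F_k$, it is active on the user's spectrum ($\xi_i=1$) with probability $w_k$ and otherwise inactive ($\xi_i=0$). The channel gain $g_0$ of the serving link is Rayleigh faded, with $p\,g_0$ exponentially distributed of rate $1/p$ (that is, $g_0$ is exponential with mean $1$); the gains of the interfering links are positive almost surely and identically distributed, and $G$ denotes a random variable with the common law of $p\,g_i$, with $\mathbb E[G^{2/\alpha}]<\infty$. The positions, $g_0$, all the $g_i$ and all the $\xi_i$ are independent. (In particular $w_k\equiv 1$ gives $\lambda_I=\lambda_A$,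 and $\sum_k w_k=1$ is allowed.) Let $$\mathrm{SINR}=\frac{g_0 r_0^{-\alpha}p}{I+\sigma^2},\qquad I=\sum_{i\in\mathcal F\setminus\{0\}}\xi_i g_i r_i^{-\alpha}p,\qquad P_c=\Pr(\mathrm{SINR}>T).$$ Then $$P_c=\pi\lambda_A\int_0^\infty \exp\{-(Az+Bz^{\alpha/2})\}\,dz,\qquad A=\pi[\lambda_I(\beta-1)+\lambda_A],\qquad B=\frac{T\sigma^2}{p},$$ where the integral converges and $$\beta=\frac{2(T/p)^{2/\alpha}}{\alpha}\,\mathbb E\Big[G^{2/\alpha}\Big(\Gamma\big(-\tfrac2\alpha,\tfrac{TG}{p}\big)-\Gamma\big(-\tfrac2\alpha\big)\Big)\Big],$$ the expectation being finite; here $\Gamma(\cdot)$ is the Gamma function and $\Gamma(a,z)=\int_z^\infty x^{a-1}e^{-x}\,dx$ the upper incomplete Gamma function. -/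

import Mathlib

open MeasureTheory ProbabilityTheory Set
open scoped NNReal ENNReal

noncomputable section

/-- The plane in which base stations (BSs) are deployed; the typical user sits at the origin. -/
abbrev Plane : Type := EuclideanSpace ℝ (Fin 2)

/-- The counting measure (with multiplicity) of the random points `X i`, `i ∈ ι`:
`countMeasure X ω B` is the number of indices `i` with `X i ω ∈ B`. -/
def countMeasure {Ω ι : Type*} (X : ι → Ω → Plane) (ω : Ω) : Measure Plane :=
  Measure.sum fun i => Measure.dirac (X i ω)

/-- The random measure `N` is a homogeneous Poisson point process of intensity `lam` in the plane:
the number of points in a measurable set of finite area is Poisson with mean `lam` times the area,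
and the numbers of points in pairwise disjoint measurable sets are independent. -/
structure IsHomogeneousPPP {Ω : Type*} [MeasurableSpace Ω] (μ : Measure Ω)
    (N : Ω → Measure Plane) (lam : ℝ≥0) : Prop where
  measurable : Measurable N
  poisson : ∀ B : Set Plane, MeasurableSet B → volume B ≠ ∞ →
    μ.map (fun ω => N ω B) =
      (poissonMeasure (lam * (volume B).toNNReal)).map (fun n : ℕ => (n : ℝ≥0∞))
  indep : ∀ (n : ℕ) (B : Fin n → Set Plane), (∀ j, MeasurableSet (B j)) →
    Pairwise (fun j j' => Disjoint (B j) (B j')) → iIndepFun (fun j ω => N ω (B j)) μ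

/-- The downlink network. The BSs available to the typical user are indexed by the countable set
`ι`; BS `i` belongs to the operator `op i`, is located at `X i`, is active on the spectrum used by
the typical user iff `ξ i = true`, and has co-channel gain `g i` towards the typical user when it
interferes. The gain of the useful link is `g0`. All BSs transmit with power `p`.
* The BSs of the different operators form independent homogeneous Poisson point processes, of
  intensity `lam k` for operator `k`.
* A BS of operator `k` is active with probability `w k`.
* The useful link is Rayleigh: `p * g0` is exponential with rate `1 / p`.
* The interfering links have an arbitrary common law: `p * g i` has law `ν`.
* Positions, `g0`, all the `g i` and all the `ξ i` are independent. -/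
structure IsNetwork {Ω κ ι : Type*} [MeasurableSpace Ω] (μ : Measure Ω)
    (lam : κ → ℝ≥0) (w : κ → ℝ) (p : ℝ) (ν : Measure ℝ)
    (op : ι → κ) (X : ι → Ω → Plane) (ξ : ι → Ω → Bool) (g0 : Ω → ℝ) (g : ι → Ω → ℝ) :
    Prop where
  measurable_X : ∀ i, Measurable (X i)
  measurable_ξ : ∀ i, Measurable (ξ i)
  measurable_g0 : Measurable g0
  measurable_g : ∀ i, Measurable (g i)
  ppp : ∀ k, IsHomogeneousPPP μ (countMeasure fun i : {i : ι // op i = k} => X i) (lam k)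
  indep_operators :
    iIndepFun (fun k => countMeasure fun i : {i : ι // op i = k} => X i) μ
  active_prob : ∀ i, μ {ω | ξ i ω = true} = ENNReal.ofReal (w (op i))
  rayleigh : μ.map (fun ω => p * g0 ω) = expMeasure (1 / p)
  gain_law : ∀ i, μ.map (fun ω => p * g i ω) = ν
  indep_positions :
    IndepFun (fun ω i => X i ω) (fun ω => (g0 ω, fun i => (g i ω, ξ i ω))) μ
  indep_g0 : IndepFun g0 (fun ω i => (g i ω, ξ i ω)) μ
  indep_marks : iIndepFun (fun i ω => (g i ω, ξ i ω)) μ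
  indep_gain_active : ∀ i, IndepFun (g i) (ξ i) μ

/-- Intensity of the BSs with which the user may associate. -/
def associationIntensity {κ : Type*} [Fintype κ] (lam : κ → ℝ≥0) : ℝ := ∑ k, (lam k : ℝ)

/-- Intensity of the active BSs. -/
def interferenceIntensity {κ : Type*} [Fintype κ] (lam : κ → ℝ≥0) (w : κ → ℝ) : ℝ :=
  ∑ k, w k * (lam k : ℝ)

/-- BS `b` is a nearest BS to the origin. -/
def IsNearest {Ω ι : Type*} (X : ι → Ω → Plane) (ω : Ω) (b : ι) : Prop :=
  ∀ i, ‖X b ω‖ ≤ ‖X i ω‖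

open Classical in
/-- Interference power at the origin when BS `b` serves the user:
the sum of `ξ i * g i * r i ^ (-α) * p` over the BSs `i ≠ b`. -/
def interference {Ω ι : Type*} (p α : ℝ) (X : ι → Ω → Plane) (ξ : ι → Ω → Bool)
    (g : ι → Ω → ℝ) (ω : Ω) (b : ι) : ℝ≥0∞ :=
  ∑' i, if i ≠ b ∧ ξ i ω = true then ENNReal.ofReal (g i ω * ‖X i ω‖ ^ (-α) * p) else 0

/-- The SINR at the origin when BS `b` serves the user. -/
def sinr {Ω ι : Type*} (p α σ : ℝ) (X : ι → Ω → Plane) (ξ : ι → Ω → Bool)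
    (g0 : Ω → ℝ) (g : ι → Ω → ℝ) (ω : Ω) (b : ι) : ℝ≥0∞ :=
  ENNReal.ofReal (g0 ω * ‖X b ω‖ ^ (-α) * p) /
    (interference p α X ξ g ω b + ENNReal.ofReal (σ ^ 2))

/-- The probability that the SINR of the user served by its nearest BS exceeds `T`. -/
def coverageProbability {Ω ι : Type*} [MeasurableSpace Ω] (μ : Measure Ω) (T p α σ : ℝ)
    (X : ι → Ω → Plane) (ξ : ι → Ω → Bool) (g0 : Ω → ℝ) (g : ι → Ω → ℝ) : ℝ :=
  μ.real {ω | ∃ b, IsNearest X ω b ∧ ENNReal.ofReal T < sinr p α σ X ξ g0 g ω b}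

/-- The upper incomplete Gamma function `Γ(a, z)`, `z > 0`. -/
def upperGamma (a z : ℝ) : ℝ := ∫ x in Ioi z, x ^ (a - 1) * Real.exp (-x)

/-- The random quantity whose expectation enters `β`. -/
def betaIntegrand (T p α : ℝ) (g : ℝ) : ℝ :=
  g ^ (2 / α) * (upperGamma (-2 / α) (T * g / p) - Real.Gamma (-2 / α))

/-- The coefficient `β`; `ν` is the law of the interferers' gains (transmit power included). -/
def betaCoeff (T p α : ℝ) (ν : Measure ℝ) : ℝ :=
  2 * (T / p) ^ (2 / α) / α * ∫ g, betaIntegrand T p α g ∂ν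

/-- The coefficient `A`. -/
def coeffA (lamA lamI β : ℝ) : ℝ := Real.pi * (lamI * (β - 1) + lamA)

/-- The coefficient `B`. -/
def coeffB (T p σ : ℝ) : ℝ := T * σ ^ 2 / p

end

open Filter Topology

/-! Write `R` for the squared distance to the nearest BS and `θ(r) = (T / p) r ^ (α / 2)`. The event
`SINR > T` says that `g0` exceeds `θ(R)` times noise plus interference. Since `g0` is exponential of
mean 1 and independent of the rest, its probability is `E[exp (-θ(R) (σ² + I))]`
(`measure_coverage`). The problem is thereby reduced to a Laplace transform of a Poisson shot noise,
taken jointly with `R`.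

Squared distances are used throughout because area becomes `π` times Lebesgue measure in that
coordinate. Hence `R` is exponential of rate `π λ_A` (`map_nearestSq`). Given `R = r`, the BSs
beyond `r` should still be Poisson, so that the interference contributes `exp (-π λ_I ∫_r^∞ (1 -
L(θ(r) y ^ (-α / 2))) dy)`, where `L` is the Laplace transform of `ν`. The scaling `y = r v` makes
this integral proportional to `r`, and the incomplete Gamma identity evaluates it as `r (β - 1)`
(`lintegral_one_sub_laplaceTransform`). Integrating the result against the density of `R` gives the
formula.

The conditioning on `R` is made rigorous without Palm calculus. The Laplace functional of the marked
process (`laplace_marked`) may carry the weight `∞`, which encodes the absence of BSs in a disc. So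
`laplace_void` computes the Laplace transform of the power from beyond `t` on the event `u ≤ R`, for
`u ≤ t`. Subtracting the case `u = t` from `u = s` gives an exact product formula on `s ≤ R < t`
(`setLIntegral_farSum`). Summing over the cells of a grid and refining it yields the identity at `R`
itself (`lintegral_eq_of_interval_factorization`). Local finiteness and uniqueness of the nearest BS
(`ae_finite_near`, `ae_unique_nearest`) identify the limit with the interference. -/

noncomputable section

/-! ### The decreasing exponential on `[0, ∞]` -/

/-- The function `x ↦ exp (-x)` on `[0, ∞]`, with value `0` at `∞`. -/
def expNeg (x : ℝ≥0∞) : ℝ≥0∞ := EReal.exp (-(x : EReal))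

lemma expNeg_zero : expNeg 0 = 1 := by simp [expNeg]

lemma expNeg_top : expNeg ∞ = 0 := by simp [expNeg]

lemma continuous_expNeg : Continuous expNeg := by
  unfold expNeg
  exact ENNReal.continuous_exp.comp (continuous_neg.comp continuous_coe_ennreal_ereal)

@[fun_prop]
lemma measurable_expNeg : Measurable expNeg := continuous_expNeg.measurable

lemma antitone_expNeg : Antitone expNeg := fun x y h => by
  unfold expNeg
  apply EReal.exp_monotone
  rw [EReal.neg_le_neg_iff]
  exact_mod_cast h

lemma expNeg_le_one (x : ℝ≥0∞) : expNeg x ≤ 1 := by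
  rw [← expNeg_zero]; exact antitone_expNeg bot_le

lemma expNeg_ne_top (x : ℝ≥0∞) : expNeg x ≠ ∞ := ((expNeg_le_one x).trans_lt (by simp)).ne

lemma expNeg_add (x y : ℝ≥0∞) : expNeg (x + y) = expNeg x * expNeg y := by
  unfold expNeg
  have h1 : ∀ z : ℝ≥0∞, EReal.exp (z : EReal) ≠ 0 := fun z => by simp
  rw [EReal.exp_neg, EReal.exp_neg, EReal.exp_neg, EReal.coe_ennreal_add, EReal.exp_add,
    ENNReal.mul_inv (Or.inl (h1 x)) (Or.inr (h1 y))]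

lemma expNeg_sum {ι : Type*} (s : Finset ι) (f : ι → ℝ≥0∞) :
    expNeg (∑ i ∈ s, f i) = ∏ i ∈ s, expNeg (f i) := by
  classical
  induction s using Finset.induction_on with
  | empty => simp [expNeg_zero]
  | insert a s ha ih => rw [Finset.sum_insert ha, Finset.prod_insert ha, expNeg_add, ih]

lemma expNeg_ofReal {x : ℝ} (hx : 0 ≤ x) :
    expNeg (ENNReal.ofReal x) = ENNReal.ofReal (Real.exp (-x)) := by
  rw [expNeg, EReal.coe_ennreal_ofReal, max_eq_left hx, ← EReal.coe_neg, EReal.exp_coe]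

lemma expNeg_mul_natCast (c : ℝ≥0∞) (n : ℕ) : expNeg (c * n) = expNeg c ^ n := by
  induction n with
  | zero => simp [expNeg_zero]
  | succ n ih => rw [Nat.cast_succ, mul_add, mul_one, expNeg_add, ih, pow_succ]

/-- The inverse of `expNeg` on `[0, 1]`. -/
def negLog (q : ℝ≥0∞) : ℝ≥0∞ := (-(ENNReal.log q)).toENNReal

@[fun_prop]
lemma measurable_negLog : Measurable negLog := by
  unfold negLog
  fun_prop

lemma expNeg_negLog {q : ℝ≥0∞} (hq : q ≤ 1) : expNeg (negLog q) = q := by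
  have : ENNReal.log q ≤ 0 := by simpa using hq
  rw [expNeg, negLog, EReal.coe_toENNReal (by simpa using this), neg_neg, ENNReal.exp_log]

lemma tendsto_expNeg_tsum {ι : Type*} (f : ι → ℝ≥0∞) :
    Tendsto (fun s : Finset ι => ∏ i ∈ s, expNeg (f i)) atTop (𝓝 (expNeg (∑' i, f i))) := by
  simp_rw [← expNeg_sum]
  exact (continuous_expNeg.tendsto _).comp ENNReal.summable.hasSum

/-! ### Laplace functional of a Poisson point process -/

section Poisson

variable {Ω : Type*} [MeasurableSpace Ω] {μ : Measure Ω}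

lemma lintegral_pow_poissonMeasure (m : ℝ≥0) {q : ℝ≥0∞} (hq : q ≤ 1) :
    ∫⁻ n, q ^ n ∂(poissonMeasure m) = expNeg (m * (1 - q)) := by
  lift q to ℝ≥0 using (hq.trans_lt (by simp)).ne
  have hq' : q ≤ 1 := by exact_mod_cast hq
  have e1 : ((m : ℝ≥0∞) * (1 - (q : ℝ≥0∞))) = ENNReal.ofReal (m * (1 - q)) := by
    rw [ENNReal.ofReal_mul m.coe_nonneg, ENNReal.ofReal_sub _ q.coe_nonneg]
    simp
  rw [e1, expNeg_ofReal (mul_nonneg m.coe_nonneg (by simpa using hq')), poissonMeasure,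
    lintegral_sum_measure]
  simp only [lintegral_smul_measure, lintegral_dirac, smul_eq_mul]
  have e2 : ∀ n : ℕ, ENNReal.ofReal (Real.exp (-m) * m ^ n / n.factorial) * (q : ℝ≥0∞) ^ n =
      ENNReal.ofReal (Real.exp (-m) * ((m * q : ℝ) ^ n / n.factorial)) := by
    intro n
    rw [← ENNReal.ofReal_coe_nnreal (p := q), ← ENNReal.ofReal_pow q.coe_nonneg,
      ← ENNReal.ofReal_mul (by positivity)]
    congr 1
    rw [mul_pow]; ring
  have hs : HasSum (fun n : ℕ => Real.exp (-m) * ((m * q : ℝ) ^ n / n.factorial))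
      (Real.exp (-m) * Real.exp (m * q)) := by
    have := NormedSpace.expSeries_div_hasSum_exp (m * q : ℝ)
    rw [← Real.exp_eq_exp_ℝ] at this
    exact this.mul_left _
  simp_rw [e2]
  rw [← ENNReal.ofReal_tsum_of_nonneg (fun n => by positivity) hs.summable, hs.tsum_eq,
    ← Real.exp_add]
  congr 2; ring

namespace IsHomogeneousPPP

variable {N : Ω → Measure Plane} {lam : ℝ≥0}

lemma measurable_apply (h : IsHomogeneousPPP μ N lam) {B : Set Plane} (hB : MeasurableSet B) :
    Measurable fun ω => N ω B := (Measure.measurable_coe hB).comp h.measurable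

/-- The Poisson generating function at `q = exp (-c)`. The value `c = ∞` is included and gives the
void probability, since `∞ * 0 = 0` and `0 ^ 0 = 1`. -/
lemma laplace_set (h : IsHomogeneousPPP μ N lam) {B : Set Plane} (hB : MeasurableSet B)
    (hfin : volume B ≠ ∞) (c : ℝ≥0∞) :
    ∫⁻ ω, expNeg (c * N ω B) ∂μ = expNeg (lam * ((1 - expNeg c) * volume B)) := by
  have h1 : ∫⁻ ω, expNeg (c * N ω B) ∂μ
      = ∫⁻ x, expNeg (c * x) ∂(μ.map (fun ω => N ω B)) := by
    rw [lintegral_map (by fun_prop) (h.measurable_apply hB)]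
  rw [h1, h.poisson B hB hfin, lintegral_map (by fun_prop) .of_discrete]
  simp_rw [expNeg_mul_natCast]
  rw [lintegral_pow_poissonMeasure _ (expNeg_le_one c)]
  congr 1
  rw [ENNReal.coe_mul, ENNReal.coe_toNNReal hfin]
  ring

/-- The level sets are disjoint, so their counts are independent Poisson variables and the
expectation factorises. The level set of `0` may have infinite area, but its factor is 1. -/
lemma laplace_simpleFunc [IsProbabilityMeasure μ] (h : IsHomogeneousPPP μ N lam)
    (f : SimpleFunc Plane ℝ≥0∞)
    (hf : ∀ c ≠ 0, volume (f ⁻¹' {c}) ≠ ∞) :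
    ∫⁻ ω, expNeg (∫⁻ x, f x ∂(N ω)) ∂μ = expNeg (lam * ∫⁻ x, (1 - expNeg (f x))) := by
  have e1 : ∀ ω, expNeg (∫⁻ x, f x ∂(N ω))
      = ∏ c ∈ f.range, expNeg (c * N ω (f ⁻¹' {c})) := by
    intro ω
    rw [SimpleFunc.lintegral_eq_lintegral, SimpleFunc.lintegral, expNeg_sum]
  have hmeas : ∀ c, MeasurableSet (f ⁻¹' {c}) := fun c => f.measurableSet_fiber c
  let e := f.range.equivFin
  have hind : iIndepFun (fun (c : f.range) ω => N ω (f ⁻¹' {(c : ℝ≥0∞)})) μ := by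
    have := h.indep f.range.card (fun j => f ⁻¹' {((e.symm j : f.range) : ℝ≥0∞)})
      (fun j => hmeas _) (fun j j' hjj' => by
        apply Disjoint.preimage
        rw [disjoint_singleton]
        intro hh
        exact hjj' (e.symm.injective (Subtype.ext hh)))
    have h2 := this.precomp e.injective
    simpa using h2
  have hind' : iIndepFun (fun (c : f.range) ω => expNeg (c * N ω (f ⁻¹' {(c : ℝ≥0∞)}))) μ :=
    hind.comp (fun (c : f.range) x => expNeg (c * x))
      (fun c => measurable_expNeg.comp (measurable_const_mul _))
  simp_rw [e1]
  have e2 : ∀ ω, ∏ c ∈ f.range, expNeg (c * N ω (f ⁻¹' {c}))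
      = ∏ c : f.range, expNeg (c * N ω (f ⁻¹' {(c : ℝ≥0∞)})) := fun ω =>
    (Finset.prod_coe_sort f.range (fun c => expNeg (c * N ω (f ⁻¹' {c})))).symm
  simp_rw [e2]
  rw [lintegral_prod_eq_prod_lintegral_of_indepFun Finset.univ _ hind' (fun c =>
    measurable_expNeg.comp ((measurable_const_mul _).comp (h.measurable_apply (hmeas _))))]
  have e3 : ∀ c : f.range, ∫⁻ ω, expNeg (c * N ω (f ⁻¹' {(c : ℝ≥0∞)})) ∂μ
      = expNeg (lam * ((1 - expNeg c) * volume (f ⁻¹' {(c : ℝ≥0∞)}))) := by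
    intro c
    by_cases hc : (c : ℝ≥0∞) = 0
    · simp [hc, expNeg_zero]
    · exact h.laplace_set (hmeas _) (hf _ hc) _
  simp_rw [e3]
  rw [Finset.prod_coe_sort f.range
    (fun c => expNeg (lam * ((1 - expNeg c) * volume (f ⁻¹' {c})))), ← expNeg_sum,
    ← Finset.mul_sum]
  congr 2
  rw [← SimpleFunc.map_lintegral (fun c => 1 - expNeg c) f, ← SimpleFunc.lintegral_eq_lintegral]
  rfl

/-- The Laplace functional of a Poisson point process. -/
lemma laplace [IsProbabilityMeasure μ] (h : IsHomogeneousPPP μ N lam)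
    {f : Plane → ℝ≥0∞} (hf : Measurable f) :
    ∫⁻ ω, expNeg (∫⁻ x, f x ∂(N ω)) ∂μ = expNeg (lam * ∫⁻ x, (1 - expNeg (f x))) := by
  let S := spanningSets (volume : Measure Plane)
  -- Cutting off to sets of finite area makes the nonzero level sets finite and keeps the
  -- approximation monotone.
  let F : ℕ → SimpleFunc Plane ℝ≥0∞ := fun n => (SimpleFunc.eapprox f n).restrict (S n)
  have hS : ∀ n, MeasurableSet (S n) := measurableSet_spanningSets _
  have hF : ∀ n x, F n x = (S n).indicator (SimpleFunc.eapprox f n) x := fun n x =>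
    SimpleFunc.restrict_apply _ (hS n) x
  have hmono : ∀ x, Monotone fun n => F n x := by
    intro x n m hnm
    simp only [hF]
    exact (indicator_le_indicator_of_subset (monotone_spanningSets _ hnm) (fun _ => bot_le) x).trans
      (indicator_le_indicator (SimpleFunc.monotone_eapprox f hnm x))
  have hsup : ∀ x, ⨆ n, F n x = f x := by
    intro x
    refine le_antisymm (iSup_le fun n => ?_) ?_
    · rw [hF]
      refine (indicator_le_self _ _ x).trans ?_
      rw [← SimpleFunc.iSup_eapprox_apply hf x]
      exact le_iSup (fun n => SimpleFunc.eapprox f n x) n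
    · obtain ⟨n0, hn0⟩ := mem_iUnion.1 ((iUnion_spanningSets (volume : Measure Plane)).symm ▸
        mem_univ x : x ∈ ⋃ n, S n)
      rw [← SimpleFunc.iSup_eapprox_apply hf x]
      refine iSup_le fun n => ?_
      refine le_trans ?_ (le_iSup _ (max n n0))
      rw [hF, indicator_of_mem (monotone_spanningSets _ (le_max_right n n0) hn0)]
      exact SimpleFunc.monotone_eapprox f (le_max_left _ _) x
  have hlim : ∀ x, Tendsto (fun n => F n x) atTop (𝓝 (f x)) := fun x => by
    rw [← hsup x]; exact tendsto_atTop_iSup (hmono x)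
  have hfin : ∀ n, ∀ c ≠ 0, volume (F n ⁻¹' {c}) ≠ ∞ := by
    intro n c hc
    refine ((measure_mono ?_).trans_lt (measure_spanningSets_lt_top volume n)).ne
    intro x hx
    by_contra hxn
    have : F n x = c := hx
    rw [hF, indicator_of_notMem hxn] at this
    exact hc this.symm
  have hL : Tendsto (fun n => ∫⁻ ω, expNeg (∫⁻ x, F n x ∂(N ω)) ∂μ) atTop
      (𝓝 (∫⁻ ω, expNeg (∫⁻ x, f x ∂(N ω)) ∂μ)) := by
    refine tendsto_lintegral_of_dominated_convergence (fun _ => 1) (fun n => ?_) (fun n => ?_)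
      (by simp) ?_
    · exact measurable_expNeg.comp
        ((Measure.measurable_lintegral (F n).measurable).comp h.measurable)
    · exact Eventually.of_forall fun ω => expNeg_le_one _
    · refine Eventually.of_forall fun ω => ?_
      refine (continuous_expNeg.tendsto _).comp ?_
      exact lintegral_tendsto_of_tendsto_of_monotone (fun n => (F n).measurable.aemeasurable)
        (Eventually.of_forall hmono) (Eventually.of_forall hlim)
  have hR : Tendsto (fun n => expNeg (lam * ∫⁻ x, (1 - expNeg (F n x)))) atTop
      (𝓝 (expNeg (lam * ∫⁻ x, (1 - expNeg (f x))))) := by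
    refine (continuous_expNeg.tendsto _).comp ?_
    refine ENNReal.Tendsto.const_mul ?_ (Or.inr ENNReal.coe_ne_top)
    refine lintegral_tendsto_of_tendsto_of_monotone (fun n =>
      (measurable_const.sub (measurable_expNeg.comp (F n).measurable)).aemeasurable)
      (Eventually.of_forall fun x n m hnm => ?_) (Eventually.of_forall fun x => ?_)
    · exact tsub_le_tsub_left (antitone_expNeg (hmono x hnm)) _
    · exact ENNReal.Tendsto.sub tendsto_const_nhds ((continuous_expNeg.tendsto _).comp (hlim x))
        (Or.inl (by simp))
  refine tendsto_nhds_unique hL ?_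
  simp_rw [fun n => h.laplace_simpleFunc (F n) (hfin n)]
  exact hR

end IsHomogeneousPPP

end Poisson

/-! ### Independence, Fubini and infinite products -/

section Independence

variable {Ω α β : Type*} [MeasurableSpace Ω] [MeasurableSpace α] [MeasurableSpace β]
  {μ : Measure Ω}

/-- Fubini for functions of two independent random variables. -/
lemma lintegral_comp_of_indepFun [IsProbabilityMeasure μ] {U : Ω → α} {V : Ω → β}
    (h : IndepFun U V μ) (hU : Measurable U) (hV : Measurable V) {F : α × β → ℝ≥0∞}
    (hF : Measurable F) :
    ∫⁻ ω, F (U ω, V ω) ∂μ = ∫⁻ ω, ∫⁻ ω', F (U ω, V ω') ∂μ ∂μ := by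
  have := Measure.isProbabilityMeasure_map (μ := μ) hV.aemeasurable
  rw [← lintegral_map hF (hU.prodMk hV),
    (indepFun_iff_map_prod_eq_prod_map_map hU.aemeasurable hV.aemeasurable).1 h,
    lintegral_prod _ hF.aemeasurable, lintegral_map hF.lintegral_prod_right' hU]
  refine lintegral_congr fun ω => ?_
  exact lintegral_map (hF.comp measurable_prodMk_left) hV

/-- If `U` is independent of `(V, W)` and `V` is independent of `W`, then `(U, W)` is independent
of `V`. -/
lemma IndepFun.prod_of_prod {γ : Type*} [MeasurableSpace γ] [IsProbabilityMeasure μ]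
    {U : Ω → α} {V : Ω → β} {W : Ω → γ} (hU : Measurable U) (hV : Measurable V)
    (hW : Measurable W) (h : IndepFun U (fun ω => (V ω, W ω)) μ) (h' : IndepFun V W μ) :
    IndepFun (fun ω => (U ω, W ω)) V μ := by
  have hUW : IndepFun U W μ := h.comp measurable_id measurable_snd
  have := Measure.isProbabilityMeasure_map (μ := μ) hU.aemeasurable
  have := Measure.isProbabilityMeasure_map (μ := μ) hV.aemeasurable
  have := Measure.isProbabilityMeasure_map (μ := μ) hW.aemeasurable
  have h1 := (indepFun_iff_map_prod_eq_prod_map_map hU.aemeasurable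
    (hV.prodMk hW).aemeasurable).1 h
  rw [(indepFun_iff_map_prod_eq_prod_map_map hV.aemeasurable hW.aemeasurable).1 h'] at h1
  rw [indepFun_iff_map_prod_eq_prod_map_map (hU.prodMk hW).aemeasurable hV.aemeasurable,
    (indepFun_iff_map_prod_eq_prod_map_map hU.aemeasurable hW.aemeasurable).1 hUW]
  symm
  refine Measure.prod_eq_generateFrom (C := image2 (· ×ˢ ·) {s : Set α | MeasurableSet s}
    {t : Set γ | MeasurableSet t}) (D := {s : Set β | MeasurableSet s}) generateFrom_prod
    MeasurableSpace.generateFrom_measurableSet isPiSystem_prod MeasurableSpace.isPiSystem_measurableSet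
    ?_ ?_ ?_
  · exact ⟨fun _ => univ, fun _ => ⟨univ, MeasurableSet.univ, univ, MeasurableSet.univ, by simp⟩,
      fun _ => measure_lt_top _ _, iUnion_const _⟩
  · exact (Measure.map V μ).toFiniteSpanningSetsIn.mono (fun s hs => hs)
  · rintro _ ⟨A, hA, C, hC, rfl⟩ B hB
    have hA : MeasurableSet A := hA
    have hB : MeasurableSet B := hB
    have hC : MeasurableSet C := hC
    rw [Measure.prod_prod, Measure.map_apply ((hU.prodMk hW).prodMk hV) ((hA.prod hC).prod hB)]
    have h2 := congrArg (fun m => m (A ×ˢ (B ×ˢ C))) h1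
    simp only [Measure.prod_prod] at h2
    rw [Measure.map_apply (hU.prodMk (hV.prodMk hW)) (hA.prod (hB.prod hC))] at h2
    rw [mul_assoc, mul_comm ((Measure.map W μ) C), ← h2]
    congr 1
    ext ω
    simp only [mem_preimage, mem_prod]
    tauto

/-- Finite products factorise, and dominated convergence along finite sets passes to the infinite
product. Writing that product as the exponential of a sum of `negLog` gives it the shape of a
Laplace functional again, so that independent marks can be averaged out first and the positions
afterwards. -/
lemma lintegral_expNeg_tsum_of_iIndepFun {ι : Type*} [Countable ι] [IsProbabilityMeasure μ]
    {Z : ι → Ω → ℝ≥0∞} (hZ : ∀ i, Measurable (Z i)) (h : iIndepFun Z μ) :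
    ∫⁻ ω, expNeg (∑' i, Z i ω) ∂μ = expNeg (∑' i, negLog (∫⁻ ω, expNeg (Z i ω) ∂μ)) := by
  have hle : ∀ i, ∫⁻ ω, expNeg (Z i ω) ∂μ ≤ 1 := fun i =>
    (lintegral_mono fun ω => expNeg_le_one _).trans (by simp)
  have hind : iIndepFun (fun i ω => expNeg (Z i ω)) μ := h.comp _ fun _ => measurable_expNeg
  have h1 := tendsto_expNeg_tsum fun i => negLog (∫⁻ ω, expNeg (Z i ω) ∂μ)
  refine tendsto_nhds_unique ?_ h1
  have h2 : ∀ s : Finset ι, ∏ i ∈ s, expNeg (negLog (∫⁻ ω, expNeg (Z i ω) ∂μ))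
      = ∫⁻ ω, ∏ i ∈ s, expNeg (Z i ω) ∂μ := fun s => by
    rw [lintegral_prod_eq_prod_lintegral_of_indepFun s _ hind fun i =>
      measurable_expNeg.comp (hZ i)]
    exact Finset.prod_congr rfl fun i _ => expNeg_negLog (hle i)
  simp_rw [h2]
  refine tendsto_lintegral_filter_of_dominated_convergence (fun _ => 1) (Eventually.of_forall
    fun s => ?_) (Eventually.of_forall fun s => Eventually.of_forall fun ω => ?_) (by simp)
    (Eventually.of_forall fun ω => tendsto_expNeg_tsum _)
  · fun_prop
  · rw [← expNeg_sum]; exact expNeg_le_one _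

end Independence

/-! ### Laplace functional of the marked network -/

/-- The Laplace transform of the law `ν`. -/
def laplaceTransform (ν : Measure ℝ) (a : ℝ≥0∞) : ℝ≥0∞ :=
  ∫⁻ x, expNeg (a * ENNReal.ofReal x) ∂ν

lemma measurable_laplaceTransform (ν : Measure ℝ) [SFinite ν] : Measurable (laplaceTransform ν) := by
  unfold laplaceTransform
  exact Measurable.lintegral_prod_right (by fun_prop)

namespace IsNetwork

variable {Ω κ ι : Type*} [MeasurableSpace Ω] {μ : Measure Ω} [IsProbabilityMeasure μ]
  {lam : κ → ℝ≥0} {w : κ → ℝ} {p : ℝ} {ν : Measure ℝ}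
  {op : ι → κ} {X : ι → Ω → Plane} {ξ : ι → Ω → Bool} {g0 : Ω → ℝ} {g : ι → Ω → ℝ}

lemma laplace [Fintype κ] (h : IsNetwork μ lam w p ν op X ξ g0 g)
    {f : κ → Plane → ℝ≥0∞} (hf : ∀ k, Measurable (f k)) :
    ∫⁻ ω, expNeg (∑' i, f (op i) (X i ω)) ∂μ =
      expNeg (∑ k, lam k * ∫⁻ x, (1 - expNeg (f k x))) := by
  let N : κ → Ω → Measure Plane := fun k => countMeasure fun i : {i : ι // op i = k} => X i
  have e : ∀ ω, ∑' i, f (op i) (X i ω) = ∑ k, ∫⁻ x, f k x ∂(N k ω) := by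
    intro ω
    rw [← (Equiv.sigmaFiberEquiv op).tsum_eq, ENNReal.tsum_sigma', tsum_fintype]
    refine Finset.sum_congr rfl fun k _ => ?_
    simp only [N, countMeasure, lintegral_sum_measure]
    refine tsum_congr fun i => ?_
    rw [lintegral_dirac' _ (hf k)]
    simp [Equiv.sigmaFiberEquiv, i.2]
  have hind : iIndepFun (fun k ω => expNeg (∫⁻ x, f k x ∂(N k ω))) μ :=
    h.indep_operators.comp (fun k m => expNeg (∫⁻ x, f k x ∂m))
      (fun k => measurable_expNeg.comp (Measure.measurable_lintegral (hf k)))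
  simp_rw [e, expNeg_sum]
  rw [lintegral_prod_eq_prod_lintegral_of_indepFun Finset.univ _ hind fun k =>
    measurable_expNeg.comp ((Measure.measurable_lintegral (hf k)).comp (h.ppp k).measurable)]
  exact Finset.prod_congr rfl fun k _ => (h.ppp k).laplace (hf k)

lemma laplace_mark (h : IsNetwork μ lam w p ν op X ξ g0 g)
    (hw : ∀ k, 0 ≤ w k ∧ w k ≤ 1) (i : ι) (a b : ℝ≥0∞) :
    ∫⁻ ω, expNeg (a + if ξ i ω = true then b * ENNReal.ofReal (p * g i ω) else 0) ∂μ =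
      expNeg a * (ENNReal.ofReal (1 - w (op i)) +
        ENNReal.ofReal (w (op i)) * laplaceTransform ν b) := by
  have hξ : MeasurableSet {ω | ξ i ω = true} := h.measurable_ξ i (measurableSet_singleton true)
  have hg := h.measurable_g i
  have e : ∀ ω, expNeg (a + if ξ i ω = true then b * ENNReal.ofReal (p * g i ω) else 0) =
      expNeg a * ({ω | ξ i ω = true}ᶜ.indicator 1 ω +
        expNeg (b * ENNReal.ofReal (p * g i ω)) * {ω | ξ i ω = true}.indicator 1 ω) := by
    intro ω
    rw [expNeg_add]
    by_cases hω : ξ i ω = true <;> simp [hω, expNeg_zero]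
  simp_rw [e]
  have hm1 : Measurable ({ω | ξ i ω = true}ᶜ.indicator (1 : Ω → ℝ≥0∞)) :=
    measurable_one.indicator hξ.compl
  have hm2 : Measurable ({ω | ξ i ω = true}.indicator (1 : Ω → ℝ≥0∞)) :=
    measurable_one.indicator hξ
  have hind : IndepFun (fun ω => expNeg (b * ENNReal.ofReal (p * g i ω)))
      ({ω | ξ i ω = true}.indicator (1 : Ω → ℝ≥0∞)) μ := by
    have := (h.indep_gain_active i).comp (φ := fun x => expNeg (b * ENNReal.ofReal (p * x)))
      (ψ := fun y : Bool => if y = true then (1 : ℝ≥0∞) else 0) (by fun_prop) .of_discrete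
    convert! this using 1
    ext ω
    by_cases hω : ξ i ω = true <;> simp [hω]
  have hmul := lintegral_mul_eq_lintegral_mul_lintegral_of_indepFun (μ := μ) (by fun_prop) hm2 hind
  simp only [Pi.mul_apply] at hmul
  rw [lintegral_const_mul _ (by fun_prop), lintegral_add_left hm1, hmul,
    lintegral_indicator_one hξ, lintegral_indicator_one hξ.compl, prob_compl_eq_one_sub hξ,
    h.active_prob i, laplaceTransform, ← h.gain_law i, lintegral_map (by fun_prop) (by fun_prop),
    ENNReal.ofReal_sub _ (hw _).1, ENNReal.ofReal_one]
  ring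

lemma laplaceTransform_le_one [IsProbabilityMeasure ν] (a : ℝ≥0∞) : laplaceTransform ν a ≤ 1 :=
  (lintegral_mono fun x => expNeg_le_one _).trans (by simp)

/-- The Laplace functional of the marked network. -/
lemma laplace_marked [Fintype κ] [Countable ι] [IsProbabilityMeasure ν]
    (h : IsNetwork μ lam w p ν op X ξ g0 g)
    (hw : ∀ k, 0 ≤ w k ∧ w k ≤ 1) {a b : Plane → ℝ≥0∞} (ha : Measurable a) (hb : Measurable b) :
    ∫⁻ ω, expNeg (∑' i, (a (X i ω) +
      if ξ i ω = true then b (X i ω) * ENNReal.ofReal (p * g i ω) else 0)) ∂μ =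
      expNeg (∑ k, lam k * ∫⁻ x, (1 - expNeg (a x) * (ENNReal.ofReal (1 - w k) +
        ENNReal.ofReal (w k) * laplaceTransform ν (b x)))) := by
  have hX := measurable_pi_iff.2 h.measurable_X
  have hM : Measurable (fun ω i => (g i ω, ξ i ω)) :=
    measurable_pi_iff.2 fun i => (h.measurable_g i).prodMk (h.measurable_ξ i)
  have hle : ∀ k x, expNeg (a x) * (ENNReal.ofReal (1 - w k) +
      ENNReal.ofReal (w k) * laplaceTransform ν (b x)) ≤ 1 := by
    intro k x
    refine mul_le_one' (expNeg_le_one _) ?_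
    calc _ ≤ ENNReal.ofReal (1 - w k) + ENNReal.ofReal (w k) * 1 := by
          gcongr; exact laplaceTransform_le_one _
      _ = 1 := by
          rw [mul_one, ← ENNReal.ofReal_add (by linarith [(hw k).2]) (hw k).1]; simp
  have hind : IndepFun (fun ω i => X i ω) (fun ω i => (g i ω, ξ i ω)) μ :=
    h.indep_positions.comp measurable_id measurable_snd
  have h1 := lintegral_comp_of_indepFun hind hX hM
    (F := fun z : (ι → Plane) × (ι → ℝ × Bool) => expNeg (∑' i, (a (z.1 i) +
      if (z.2 i).2 = true then b (z.1 i) * ENNReal.ofReal (p * (z.2 i).1) else 0))) (by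
      refine measurable_expNeg.comp (Measurable.tsum fun i => ?_)
      refine Measurable.add (by fun_prop) (Measurable.ite ?_ (by fun_prop) measurable_const)
      exact (show Measurable fun z : (ι → Plane) × (ι → ℝ × Bool) => (z.2 i).2 by fun_prop)
        (measurableSet_singleton true))
  rw [h1]
  -- With the positions frozen the marks are independent. Averaging over them leaves a sum over the
  -- BSs of a function of position and operator, to which the unmarked functional applies.
  have h2 : ∀ ω, ∫⁻ ω', expNeg (∑' i, (a (X i ω) +
      if ξ i ω' = true then b (X i ω) * ENNReal.ofReal (p * g i ω') else 0)) ∂μ =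
      expNeg (∑' i, negLog (expNeg (a (X i ω)) * (ENNReal.ofReal (1 - w (op i)) +
        ENNReal.ofReal (w (op i)) * laplaceTransform ν (b (X i ω))))) := by
    intro ω
    have hφ : ∀ i, Measurable fun y : ℝ × Bool =>
        a (X i ω) + if y.2 = true then b (X i ω) * ENNReal.ofReal (p * y.1) else 0 := fun i =>
      measurable_const.add (Measurable.ite (measurable_snd (measurableSet_singleton true))
        (by fun_prop) measurable_const)
    refine (lintegral_expNeg_tsum_of_iIndepFun (fun i => (hφ i).comp
      ((h.measurable_g i).prodMk (h.measurable_ξ i))) (h.indep_marks.comp _ hφ)).trans ?_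
    congr 1
    refine tsum_congr fun i => ?_
    rw [← h.laplace_mark hw i]
    rfl
  simp_rw [h2]
  have hmb := (measurable_laplaceTransform ν).comp hb
  rw [h.laplace (f := fun k x => negLog (expNeg (a x) * (ENNReal.ofReal (1 - w k) +
        ENNReal.ofReal (w k) * laplaceTransform ν (b x)))) (fun k => by
        refine measurable_negLog.comp (Measurable.mul (by fun_prop) ?_)
        exact measurable_const.add (measurable_const.mul hmb))]
  congr 1
  refine Finset.sum_congr rfl fun k _ => ?_
  congr 1
  refine lintegral_congr fun x => ?_
  rw [expNeg_negLog (hle k x)]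

end IsNetwork

/-! ### Area in the squared radial coordinate -/

lemma volume_normSq_lt (b : ℝ) :
    volume {x : Plane | ‖x‖ ^ 2 < b} = ENNReal.ofReal Real.pi * ENNReal.ofReal b := by
  rcases le_or_gt b 0 with hb | hb
  · have : {x : Plane | ‖x‖ ^ 2 < b} = ∅ := by
      ext x
      simp only [mem_ofPred_eq, mem_empty_iff_false, iff_false, not_lt]
      exact hb.trans (by positivity)
    rw [this, ENNReal.ofReal_of_nonpos hb]; simp
  · have : {x : Plane | ‖x‖ ^ 2 < b} = Metric.ball 0 (Real.sqrt b) := by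
      ext x
      rw [mem_ball_zero_iff, Real.lt_sqrt (norm_nonneg x), mem_ofPred_eq]
    rw [this, EuclideanSpace.volume_ball_fin_two, mul_comm, ← ENNReal.ofReal_pow (Real.sqrt_nonneg _),
      Real.sq_sqrt hb.le]

/-- The area measure in squared radial coordinates. -/
lemma map_normSq_volume : (volume : Measure Plane).map (fun x => ‖x‖ ^ 2) =
    ENNReal.ofReal Real.pi • (volume : Measure ℝ).restrict (Ioi 0) := by
  have hm : Measurable fun x : Plane => ‖x‖ ^ 2 := by fun_prop
  have h1 : ∀ b : ℝ, (volume : Measure Plane).map (fun x => ‖x‖ ^ 2) (Iio b) =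
      ENNReal.ofReal Real.pi * ENNReal.ofReal b := fun b => by
    rw [Measure.map_apply hm measurableSet_Iio]; exact volume_normSq_lt b
  refine Measure.ext_of_generateFrom_of_iUnion (range Iio) (fun n : ℕ => Iio (n : ℝ)) ?_
    isPiSystem_Iio ?_ (fun n => ⟨n, rfl⟩) ?_ ?_
  · rw [← borel_eq_generateFrom_Iio]; exact BorelSpace.measurable_eq
  · rw [iUnion_eq_univ_iff]; exact fun x => exists_nat_gt x
  · intro n; rw [h1]; exact ENNReal.mul_ne_top ENNReal.ofReal_ne_top ENNReal.ofReal_ne_top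
  · rintro _ ⟨b, rfl⟩
    rw [h1, Measure.smul_apply, Measure.restrict_apply measurableSet_Iio, inter_comm, Ioi_inter_Iio,
      Real.volume_Ioo, sub_zero, smul_eq_mul]

lemma lintegral_normSq {f : ℝ → ℝ≥0∞} (hf : Measurable f) :
    ∫⁻ x : Plane, f (‖x‖ ^ 2) = ENNReal.ofReal Real.pi * ∫⁻ y in Ioi 0, f y := by
  have hm : Measurable fun x : Plane => ‖x‖ ^ 2 := by fun_prop
  rw [← lintegral_map hf hm, map_normSq_volume, lintegral_smul_measure, smul_eq_mul]

/-! ### Joint law of the nearest distance and the far interference -/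

/-- The weighted sum of the gains of the active BSs at squared distance at least `t`. -/
def farSum {Ω ι : Type*} (p : ℝ) (X : ι → Ω → Plane) (ξ : ι → Ω → Bool) (g : ι → Ω → ℝ)
    (b : ℝ → ℝ≥0∞) (t : ℝ) (ω : Ω) : ℝ≥0∞ :=
  ∑' i, if t ≤ ‖X i ω‖ ^ 2 ∧ ξ i ω = true then b (‖X i ω‖ ^ 2) * ENNReal.ofReal (p * g i ω) else 0

/-- The squared distance from the origin to the nearest BS. -/
def nearestSq {Ω ι : Type*} (X : ι → Ω → Plane) (ω : Ω) : ℝ := ⨅ i, ‖X i ω‖ ^ 2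

lemma le_nearestSq_iff {Ω ι : Type*} [Nonempty ι] {X : ι → Ω → Plane} {ω : Ω} {u : ℝ} :
    u ≤ nearestSq X ω ↔ ∀ i, u ≤ ‖X i ω‖ ^ 2 :=
  le_ciInf_iff ⟨0, by rintro _ ⟨i, rfl⟩; positivity⟩

lemma laplaceTransform_zero (ν : Measure ℝ) [IsProbabilityMeasure ν] : laplaceTransform ν 0 = 1 := by
  simp [laplaceTransform, expNeg_zero]

/-- Because `u ≤ t`, the two regions do not overlap: the integrand is 1 below `u`, vanishes between
`u` and `t`, and equals `v (1 - L)` from `t` on. This separation is what makes void event and far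
power contribute independent factors. -/
lemma lintegral_one_sub_region {ν : Measure ℝ} [IsProbabilityMeasure ν] {v : ℝ} (hv : 0 ≤ v ∧ v ≤ 1)
    {b : ℝ → ℝ≥0∞} (hb : Measurable b) {u t : ℝ} (ht : 0 < t) (hut : u ≤ t) :
    ∫⁻ y in Ioi 0, (1 - expNeg ((Iio u).indicator (fun _ => ∞) y) * (ENNReal.ofReal (1 - v) +
      ENNReal.ofReal v * laplaceTransform ν ((Ici t).indicator b y))) =
    ENNReal.ofReal u + ENNReal.ofReal v * ∫⁻ y in Ici t, (1 - laplaceTransform ν (b y)) := by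
  have hsum : ENNReal.ofReal (1 - v) + ENNReal.ofReal v = 1 := by
    rw [← ENNReal.ofReal_add (by linarith) hv.1]; simp
  have hmΦ : Measurable fun y => 1 - laplaceTransform ν (b y) :=
    measurable_const.sub ((measurable_laplaceTransform ν).comp hb)
  have e : ∀ y, (1 - expNeg ((Iio u).indicator (fun _ => ∞) y) * (ENNReal.ofReal (1 - v) +
      ENNReal.ofReal v * laplaceTransform ν ((Ici t).indicator b y))) =
      (Iio u).indicator 1 y +
        (Ici t).indicator (fun y => ENNReal.ofReal v * (1 - laplaceTransform ν (b y))) y := by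
    intro y
    by_cases h1 : y < u
    · have h2 : ¬ t ≤ y := by linarith
      simp [indicator, h1, h2, expNeg_top]
    · by_cases h2 : t ≤ y
      · simp only [indicator, mem_Iio, h1, if_false, expNeg_zero, mem_Ici, h2, if_true, one_mul,
          zero_add]
        rw [ENNReal.mul_sub (fun _ _ => ENNReal.ofReal_ne_top), mul_one, ← hsum]
        exact ENNReal.add_sub_add_eq_sub_left ENNReal.ofReal_ne_top
      · simp [indicator, h1, h2, expNeg_zero, laplaceTransform_zero, hsum]
  simp_rw [e]
  rw [lintegral_add_left (measurable_one.indicator measurableSet_Iio),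
    lintegral_indicator_one measurableSet_Iio, lintegral_indicator measurableSet_Ici,
    lintegral_const_mul _ hmΦ, Measure.restrict_apply measurableSet_Iio,
    Measure.restrict_restrict measurableSet_Ici, inter_comm, Ioi_inter_Iio, Real.volume_Ioo, sub_zero,
    inter_eq_left.2 (Ici_subset_Ioi.2 ht)]

namespace IsNetwork

variable {Ω κ ι : Type*} [MeasurableSpace Ω] {μ : Measure Ω} [IsProbabilityMeasure μ]
  {lam : κ → ℝ≥0} {w : κ → ℝ} {p : ℝ} {ν : Measure ℝ}
  {op : ι → κ} {X : ι → Ω → Plane} {ξ : ι → Ω → Bool} {g0 : Ω → ℝ} {g : ι → Ω → ℝ}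

omit [IsProbabilityMeasure μ] in
lemma measurable_farSum [Countable ι] (h : IsNetwork μ lam w p ν op X ξ g0 g) {b : ℝ → ℝ≥0∞}
    (hb : Measurable b) (t : ℝ) : Measurable (farSum p X ξ g b t) := by
  refine Measurable.tsum fun i => ?_
  have h1 := h.measurable_X i
  have h2 := h.measurable_g i
  refine Measurable.ite ?_ (by fun_prop) measurable_const
  exact (measurableSet_le measurable_const (show Measurable fun ω => ‖X i ω‖ ^ 2 by fun_prop)).inter
    (h.measurable_ξ i (measurableSet_singleton true))

omit [IsProbabilityMeasure μ] in
lemma measurable_nearestSq [Countable ι] (h : IsNetwork μ lam w p ν op X ξ g0 g) :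
    Measurable (nearestSq X) := by
  have := h.measurable_X
  exact Measurable.iInf fun i => by fun_prop

lemma laplace_radial [Fintype κ] [Countable ι] [IsProbabilityMeasure ν]
    (h : IsNetwork μ lam w p ν op X ξ g0 g)
    (hw : ∀ k, 0 ≤ w k ∧ w k ≤ 1) {a b : ℝ → ℝ≥0∞} (ha : Measurable a) (hb : Measurable b) :
    ∫⁻ ω, expNeg (∑' i, (a (‖X i ω‖ ^ 2) +
      if ξ i ω = true then b (‖X i ω‖ ^ 2) * ENNReal.ofReal (p * g i ω) else 0)) ∂μ =
      expNeg (∑ k, lam k * (ENNReal.ofReal Real.pi * ∫⁻ y in Ioi 0,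
        (1 - expNeg (a y) * (ENNReal.ofReal (1 - w k) +
        ENNReal.ofReal (w k) * laplaceTransform ν (b y))))) := by
  have hm : Measurable fun x : Plane => ‖x‖ ^ 2 := by fun_prop
  refine (h.laplace_marked hw (ha.comp hm) (hb.comp hm)).trans ?_
  congr 1
  refine Finset.sum_congr rfl fun k _ => ?_
  rw [← lintegral_normSq]
  · rfl
  · exact measurable_const.sub (Measurable.mul (by fun_prop) (measurable_const.add
      (measurable_const.mul ((measurable_laplaceTransform ν).comp hb))))

/-- The joint Laplace transform of the event that there is no BS at squared distance less than `u`
and of the power received from the BSs at squared distance at least `t`. -/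
lemma laplace_void [Fintype κ] [Countable ι] [IsProbabilityMeasure ν]
    (h : IsNetwork μ lam w p ν op X ξ g0 g)
    (hw : ∀ k, 0 ≤ w k ∧ w k ≤ 1) {b : ℝ → ℝ≥0∞} (hb : Measurable b) (c : ℝ≥0∞) {u t : ℝ}
    (hu : 0 ≤ u) (ht : 0 < t) (hut : u ≤ t) :
    ∫⁻ ω, {ω | ∀ i, u ≤ ‖X i ω‖ ^ 2}.indicator (fun ω => expNeg (c * farSum p X ξ g b t ω)) ω ∂μ =
      ENNReal.ofReal (Real.exp (-(Real.pi * associationIntensity lam * u))) *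
      expNeg (ENNReal.ofReal (Real.pi * interferenceIntensity lam w) *
        ∫⁻ y in Ici t, (1 - laplaceTransform ν (c * b y))) := by
  have hcb : Measurable fun y => c * b y := measurable_const.mul hb
  -- The weight `∞` below `u` kills every configuration with a BS there, so the exponential carries
  -- the indicator of the void event.
  have e := h.laplace_radial hw (a := (Iio u).indicator (fun _ => ∞))
    (b := (Ici t).indicator (fun y => c * b y))
    (measurable_const.indicator measurableSet_Iio) (hcb.indicator measurableSet_Ici)
  have e1 : ∀ ω, {ω | ∀ i, u ≤ ‖X i ω‖ ^ 2}.indicator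
      (fun ω => expNeg (c * farSum p X ξ g b t ω)) ω =
      expNeg (∑' i, ((Iio u).indicator (fun _ => ∞) (‖X i ω‖ ^ 2) +
      if ξ i ω = true then (Ici t).indicator (fun y => c * b y) (‖X i ω‖ ^ 2) *
        ENNReal.ofReal (p * g i ω) else 0)) := by
    intro ω
    by_cases hω : ∀ i, u ≤ ‖X i ω‖ ^ 2
    · rw [indicator_of_mem (by exact hω), farSum, ← ENNReal.tsum_mul_left]
      congr 1
      refine tsum_congr fun i => ?_
      by_cases h1 : t ≤ ‖X i ω‖ ^ 2 <;> by_cases h2 : ξ i ω = true <;>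
        simp [indicator, h1, h2, (hω i).not_gt, mul_assoc]
    · rw [indicator_of_notMem (by exact hω)]
      push Not at hω
      obtain ⟨i, hi⟩ := hω
      rw [ENNReal.tsum_eq_top_of_eq_top ⟨i, by simp [indicator, hi]⟩, expNeg_top]
  simp_rw [e1]
  rw [e]
  simp_rw [fun k => lintegral_one_sub_region (ν := ν) (hw k) hcb ht hut]
  have e2 : ENNReal.ofReal (Real.exp (-(Real.pi * associationIntensity lam * u))) =
      expNeg (ENNReal.ofReal (Real.pi * associationIntensity lam * u)) := by
    rw [expNeg_ofReal]
    unfold associationIntensity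
    positivity
  rw [e2, ← expNeg_add]
  congr 1
  have e3 : ENNReal.ofReal (Real.pi * associationIntensity lam * u) =
      ∑ k, lam k * (ENNReal.ofReal Real.pi * ENNReal.ofReal u) := by
    rw [← Finset.sum_mul, associationIntensity, mul_comm Real.pi, mul_assoc,
      ENNReal.ofReal_mul (by positivity), ENNReal.ofReal_mul Real.pi_nonneg,
      ENNReal.ofReal_sum_of_nonneg (fun k _ => by positivity)]
    simp
  have e4 : ENNReal.ofReal (Real.pi * interferenceIntensity lam w) =
      ∑ k, lam k * (ENNReal.ofReal Real.pi * ENNReal.ofReal (w k)) := by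
    rw [interferenceIntensity, ENNReal.ofReal_mul Real.pi_nonneg,
      ENNReal.ofReal_sum_of_nonneg (fun k _ => mul_nonneg (hw k).1 (lam k).coe_nonneg),
      Finset.mul_sum]
    refine Finset.sum_congr rfl fun k _ => ?_
    rw [ENNReal.ofReal_mul (hw k).1, ENNReal.ofReal_coe_nnreal]
    ring
  rw [e3, e4, Finset.sum_mul, ← Finset.sum_add_distrib]
  refine Finset.sum_congr rfl fun k _ => ?_
  ring

lemma measure_forall_le [Fintype κ] [Countable ι] [IsProbabilityMeasure ν]
    (h : IsNetwork μ lam w p ν op X ξ g0 g)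
    (hw : ∀ k, 0 ≤ w k ∧ w k ≤ 1) {u : ℝ} (hu : 0 ≤ u) :
    μ {ω | ∀ i, u ≤ ‖X i ω‖ ^ 2} =
      ENNReal.ofReal (Real.exp (-(Real.pi * associationIntensity lam * u))) := by
  -- With zero power only the void event remains; `t = u + 1` is an arbitrary admissible radius.
  have e := h.laplace_void hw (b := 0) measurable_zero 0 hu (t := u + 1) (by linarith) (by linarith)
  have hm : MeasurableSet {ω | ∀ i, u ≤ ‖X i ω‖ ^ 2} := by
    have := h.measurable_X
    rw [ofPred_forall]
    exact MeasurableSet.iInter fun i =>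
      measurableSet_le measurable_const (show Measurable fun ω => ‖X i ω‖ ^ 2 by fun_prop)
  rw [lintegral_indicator hm] at e
  simpa [laplaceTransform_zero, expNeg_zero] using e

/-- With no index every Laplace functional is 1, whereas the weight `∞` on the unit disc must give
`exp (-π λ_A) < 1`. Nonemptiness makes the infimum `nearestSq` meaningful and forces `ν` to be a
probability law. -/
lemma nonempty_of_intensity [Fintype κ] (h : IsNetwork μ lam w p ν op X ξ g0 g)
    (hlam : 0 < associationIntensity lam) : Nonempty ι := by
  by_contra hι
  rw [not_nonempty_iff] at hι
  have hB : MeasurableSet {x : Plane | ‖x‖ ^ 2 < 1} :=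
    measurableSet_lt (by fun_prop) measurable_const
  have e := h.laplace (f := fun _ => {x : Plane | ‖x‖ ^ 2 < 1}.indicator fun _ => ∞)
    (fun _ => measurable_const.indicator hB)
  have e1 : ∀ x, 1 - expNeg ({x : Plane | ‖x‖ ^ 2 < 1}.indicator (fun _ => ∞) x) =
      {x : Plane | ‖x‖ ^ 2 < 1}.indicator 1 x := fun x => by
    by_cases hx : x ∈ {x : Plane | ‖x‖ ^ 2 < 1}
    · rw [indicator_of_mem hx, indicator_of_mem hx, expNeg_top, tsub_zero, Pi.one_apply]
    · rw [indicator_of_notMem hx, indicator_of_notMem hx, expNeg_zero, tsub_self]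
  simp only [tsum_empty, expNeg_zero, lintegral_one, measure_univ, e1, lintegral_indicator_one hB,
    volume_normSq_lt, ENNReal.ofReal_one, mul_one] at e
  have e2 := e.le
  rw [expNeg, EReal.one_le_exp_iff, EReal.le_neg, neg_zero] at e2
  have e3 : ∑ k, (lam k : ℝ≥0∞) * ENNReal.ofReal Real.pi = 0 := by
    exact le_antisymm (EReal.coe_ennreal_le_coe_ennreal_iff.1 e2) bot_le
  rw [Finset.sum_eq_zero_iff] at e3
  refine hlam.ne' (Finset.sum_eq_zero fun k hk => ?_)
  have := e3 k hk
  rw [mul_eq_zero, ENNReal.coe_eq_zero, or_iff_left (ENNReal.ofReal_pos.2 Real.pi_pos).ne'] at this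
  simp [this]

lemma measure_le_nearestSq [Fintype κ] [Countable ι] [Nonempty ι] [IsProbabilityMeasure ν]
    (h : IsNetwork μ lam w p ν op X ξ g0 g)
    (hw : ∀ k, 0 ≤ w k ∧ w k ≤ 1) {u : ℝ} (hu : 0 ≤ u) :
    μ {ω | u ≤ nearestSq X ω} =
      ENNReal.ofReal (Real.exp (-(Real.pi * associationIntensity lam * u))) := by
  simp_rw [le_nearestSq_iff]
  exact h.measure_forall_le hw hu

omit [MeasurableSpace Ω] in
lemma nearestSq_nonneg [Nonempty ι] (ω : Ω) : 0 ≤ nearestSq X ω :=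
  le_nearestSq_iff.2 fun i => by positivity

/-- The squared distance to the nearest BS is exponentially distributed. -/
lemma map_nearestSq [Fintype κ] [Countable ι] [Nonempty ι] [IsProbabilityMeasure ν]
    (h : IsNetwork μ lam w p ν op X ξ g0 g)
    (hw : ∀ k, 0 ≤ w k ∧ w k ≤ 1) (hlam : 0 < associationIntensity lam) :
    μ.map (nearestSq X) = expMeasure (Real.pi * associationIntensity lam) := by
  have hpos : 0 < Real.pi * associationIntensity lam := mul_pos Real.pi_pos hlam
  have hm := h.measurable_nearestSq
  have := isProbabilityMeasure_expMeasure hpos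
  have := Measure.isProbabilityMeasure_map (μ := μ) hm.aemeasurable
  have : NullSingletonClass (expMeasure (Real.pi * associationIntensity lam)) := ⟨fun x => by
    rw [expMeasure, gammaMeasure, withDensity_apply _ (measurableSet_singleton x)]; simp⟩
  refine Measure.ext_of_Ici _ _ fun u => ?_
  rw [Measure.map_apply hm measurableSet_Ici]
  have e : expMeasure (Real.pi * associationIntensity lam) (Ici u) =
      1 - expMeasure (Real.pi * associationIntensity lam) (Iic u) := by
    rw [← prob_compl_eq_one_sub measurableSet_Iic, compl_Iic, measure_congr Ioi_ae_eq_Ici]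
  have e' : expMeasure (Real.pi * associationIntensity lam) (Iic u) = ENNReal.ofReal
      (if 0 ≤ u then 1 - Real.exp (-(Real.pi * associationIntensity lam * u)) else 0) := by
    rw [← cdf_expMeasure_eq hpos, cdf_eq_real, ofReal_measureReal]
  rw [e, e']
  split_ifs with hu
  · refine (h.measure_le_nearestSq hw hu).trans ?_
    rw [← ENNReal.ofReal_one, ← ENNReal.ofReal_sub _ (by
      rw [sub_nonneg, Real.exp_le_one_iff]; nlinarith), sub_sub_cancel]
  · rw [ENNReal.ofReal_zero, tsub_zero]
    have : nearestSq X ⁻¹' Ici u = univ := by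
      ext ω
      simp only [mem_preimage, mem_Ici, mem_univ, iff_true]
      exact (not_le.1 hu).le.trans (nearestSq_nonneg ω)
    rw [this, measure_univ]

end IsNetwork

/-! ### Local finiteness and uniqueness of the nearest BS -/

namespace IsNetwork

variable {Ω κ ι : Type*} [MeasurableSpace Ω] {μ : Measure Ω} [IsProbabilityMeasure μ]
  {lam : κ → ℝ≥0} {w : κ → ℝ} {p : ℝ} {ν : Measure ℝ}
  {op : ι → κ} {X : ι → Ω → Plane} {ξ : ι → Ω → Bool} {g0 : Ω → ℝ} {g : ι → Ω → ℝ}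

omit [IsProbabilityMeasure μ] in
lemma ae_finite_near [Fintype κ] (h : IsNetwork μ lam w p ν op X ξ g0 g) :
    ∀ᵐ ω ∂μ, ∀ m : ℕ, {i | ‖X i ω‖ ^ 2 < m}.Finite := by
  rw [ae_all_iff]
  intro m
  have hB : MeasurableSet {x : Plane | ‖x‖ ^ 2 < m} :=
    measurableSet_lt (by fun_prop) measurable_const
  have h1 : ∀ k, ∀ᵐ ω ∂μ,
      countMeasure (fun i : {i : ι // op i = k} => X i) ω {x : Plane | ‖x‖ ^ 2 < m} ≠ ∞ := by
    intro k
    have hm := (h.ppp k).measurable_apply hB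
    have hs : MeasurableSet {x : ℝ≥0∞ | x ≠ ∞} := (measurableSet_singleton ∞).compl
    rw [← ae_map_iff (p := fun x => x ≠ ∞) hm.aemeasurable hs,
      (h.ppp k).poisson _ hB (by
        rw [volume_normSq_lt]; exact ENNReal.mul_ne_top ENNReal.ofReal_ne_top ENNReal.ofReal_ne_top),
      ae_map_iff Measurable.of_discrete.aemeasurable hs]
    exact Eventually.of_forall fun n => ENNReal.natCast_ne_top n
  filter_upwards [ae_all_iff.2 h1] with ω hω
  have h2 : ∀ k, {i : {i : ι // op i = k} | ‖X i ω‖ ^ 2 < m}.Finite := by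
    intro k
    have h3 := hω k
    rw [countMeasure, Measure.sum_apply _ hB] at h3
    refine (ENNReal.finite_const_le_of_tsum_ne_top h3 one_ne_zero).subset fun i hi => ?_
    have hi : ‖X i ω‖ ^ 2 < m := hi
    simp [Measure.dirac_apply' _ hB, hi]
  have h4 : {i | ‖X i ω‖ ^ 2 < m} ⊆
      ⋃ k, (Subtype.val '' {i : {i : ι // op i = k} | ‖X i ω‖ ^ 2 < m}) := by
    intro i hi
    exact mem_iUnion.2 ⟨op i, ⟨i, rfl⟩, hi, rfl⟩
  exact (finite_iUnion fun k => (h2 k).image _).subset h4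

lemma laplace_count [Fintype κ] [Countable ι] [IsProbabilityMeasure ν]
    (h : IsNetwork μ lam w p ν op X ξ g0 g)
    (hw : ∀ k, 0 ≤ w k ∧ w k ≤ 1) {s t : ℝ} (hs : 0 ≤ s) (c : ℝ≥0∞) :
    ∫⁻ ω, expNeg (∑' i, (Ico s t).indicator (fun _ => c) (‖X i ω‖ ^ 2)) ∂μ =
      expNeg (ENNReal.ofReal (Real.pi * associationIntensity lam * (t - s)) * (1 - expNeg c)) := by
  have e := h.laplace_radial hw (a := (Ico s t).indicator (fun _ => c)) (b := 0)
    (measurable_const.indicator measurableSet_Ico) measurable_zero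
  simp only [Pi.zero_apply, zero_mul, ite_self, add_zero, laplaceTransform_zero, mul_one] at e
  rw [e]
  congr 1
  have h1 : ∀ k, ENNReal.ofReal (1 - w k) + ENNReal.ofReal (w k) = 1 := fun k => by
    rw [← ENNReal.ofReal_add (by linarith [(hw k).2]) (hw k).1]; simp
  have h2 : ∀ y, 1 - expNeg ((Ico s t).indicator (fun _ => c) y) =
      (Ico s t).indicator (fun _ => 1 - expNeg c) y := by
    intro y
    by_cases hy : y ∈ Ico s t <;> simp [indicator, hy, expNeg_zero]
  have h3 : (Ico s t ∩ Ioi 0 : Set ℝ) =ᵐ[volume] Ico s t := by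
    have := (ae_eq_refl (Ico s t)).inter (Ioi_ae_eq_Ici (μ := (volume : Measure ℝ)) (a := 0))
    rwa [inter_eq_left.2 (Ico_subset_Ici_self.trans (Ici_subset_Ici.2 hs))] at this
  simp_rw [h1, mul_one, h2]
  rw [lintegral_indicator measurableSet_Ico, Measure.restrict_restrict measurableSet_Ico,
    setLIntegral_const, measure_congr h3, Real.volume_Ico, associationIntensity,
    mul_comm Real.pi, mul_assoc,
    ENNReal.ofReal_mul (by positivity), ENNReal.ofReal_mul Real.pi_nonneg,
    ENNReal.ofReal_sum_of_nonneg (fun k _ => by positivity), ← Finset.sum_mul]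
  simp_rw [ENNReal.ofReal_coe_nnreal]
  ring

/-- Let `N` be the number of BSs in the shell, Poisson of mean `m`. Only its Laplace transform is at
hand, so the event `N ≥ 2` is bounded by transforms at `log 2` and `∞`: `½ 1{N ≥ 2} + 2 · 2 ^ (-N) ≤
1 + 1{N = 0}`, checked for `N = 0`, `N = 1` and `N ≥ 2`. Expectations give `P(N ≥ 2) ≤ 2 (1 - exp
(-m / 2))² ≤ m² / 2`. -/
lemma measure_two_in_annulus_le [Fintype κ] [Countable ι] [IsProbabilityMeasure ν]
    (h : IsNetwork μ lam w p ν op X ξ g0 g)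
    (hw : ∀ k, 0 ≤ w k ∧ w k ≤ 1) {s t : ℝ} (hs : 0 ≤ s) (hst : s ≤ t) :
    μ {ω | ∃ i j, i ≠ j ∧ ‖X i ω‖ ^ 2 ∈ Ico s t ∧ ‖X j ω‖ ^ 2 ∈ Ico s t} ≤
      ENNReal.ofReal ((Real.pi * associationIntensity lam * (t - s)) ^ 2 / 2) := by
  set E := {ω | ∃ i j, i ≠ j ∧ ‖X i ω‖ ^ 2 ∈ Ico s t ∧ ‖X j ω‖ ^ 2 ∈ Ico s t} with hE
  have hX := h.measurable_X
  have hmi : ∀ i, MeasurableSet {ω | ‖X i ω‖ ^ 2 ∈ Ico s t} := fun i =>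
    (show Measurable fun ω => ‖X i ω‖ ^ 2 by fun_prop) measurableSet_Ico
  have hEm : MeasurableSet E := by
    have : E = ⋃ i, ⋃ j, ⋃ _ : i ≠ j,
        {ω | ‖X i ω‖ ^ 2 ∈ Ico s t} ∩ {ω | ‖X j ω‖ ^ 2 ∈ Ico s t} := by
      ext ω
      simp only [hE, mem_iUnion, mem_inter_iff, exists_prop]
      rfl
    rw [this]
    exact .iUnion fun i => .iUnion fun j => .iUnion fun _ => (hmi i).inter (hmi j)
  have hhalf : expNeg (negLog 2⁻¹) = 2⁻¹ := expNeg_negLog (by simp)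
  set S : ℝ≥0∞ → Ω → ℝ≥0∞ := fun c ω => ∑' i, (Ico s t).indicator (fun _ => c) (‖X i ω‖ ^ 2) with hS
  have hSm : ∀ c, Measurable (S c) := fun c =>
    Measurable.tsum fun i => (measurable_const.indicator measurableSet_Ico).comp
      (show Measurable fun ω => ‖X i ω‖ ^ 2 by fun_prop)
  have hpt : ∀ ω, E.indicator (fun _ => 2⁻¹) ω + 2 * expNeg (S (negLog 2⁻¹) ω) ≤
      1 + expNeg (S ∞ ω) := by
    intro ω
    classical
    by_cases hω : ω ∈ E
    · rw [indicator_of_mem hω]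
      obtain ⟨i, j, hij, hi, hj⟩ := hω
      have h1 : negLog 2⁻¹ + negLog 2⁻¹ ≤ S (negLog 2⁻¹) ω := by
        have := ENNReal.sum_le_tsum (f := fun i => (Ico s t).indicator (fun _ => negLog 2⁻¹)
          (‖X i ω‖ ^ 2)) {i, j}
        rwa [Finset.sum_pair hij, indicator_of_mem hi, indicator_of_mem hj] at this
      have h2 := antitone_expNeg h1
      rw [expNeg_add, hhalf] at h2
      calc _ ≤ 2⁻¹ + 2 * ((2⁻¹ : ℝ≥0∞) * 2⁻¹) := by gcongr
        _ = 1 := by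
          rw [← mul_assoc, ENNReal.mul_inv_cancel two_ne_zero ENNReal.ofNat_ne_top, one_mul,
            ENNReal.inv_two_add_inv_two]
        _ ≤ _ := le_self_add
    · rw [indicator_of_notMem hω, zero_add]
      by_cases hex : ∃ i, ‖X i ω‖ ^ 2 ∈ Ico s t
      · obtain ⟨i, hi⟩ := hex
        have h1 : negLog 2⁻¹ ≤ S (negLog 2⁻¹) ω := by
          have := ENNReal.le_tsum (f := fun i => (Ico s t).indicator (fun _ => negLog 2⁻¹)
            (‖X i ω‖ ^ 2)) i
          rwa [indicator_of_mem hi] at this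
        have h2 := antitone_expNeg h1
        rw [hhalf] at h2
        calc _ ≤ 2 * (2⁻¹ : ℝ≥0∞) := by gcongr
          _ = 1 := ENNReal.mul_inv_cancel two_ne_zero ENNReal.ofNat_ne_top
          _ ≤ _ := le_self_add
      · push Not at hex
        have : S ∞ ω = 0 := by
          rw [hS, ENNReal.tsum_eq_zero]
          exact fun i => indicator_of_notMem (hex i) _
        rw [this, expNeg_zero, one_add_one_eq_two]
        exact mul_le_of_le_one_right' (expNeg_le_one _)
  have hint := lintegral_mono (μ := μ) hpt
  rw [lintegral_add_left (measurable_const.indicator hEm), lintegral_indicator_const hEm,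
    lintegral_const_mul _ (by fun_prop), lintegral_add_left measurable_const,
    h.laplace_count hw hs, h.laplace_count hw hs, hhalf, expNeg_top, lintegral_one, measure_univ,
    tsub_zero, mul_one, ENNReal.one_sub_inv_two] at hint
  have hm : 0 ≤ Real.pi * associationIntensity lam * (t - s) := by
    have : 0 ≤ associationIntensity lam := by unfold associationIntensity; positivity
    have : 0 ≤ t - s := by linarith
    positivity
  set m := Real.pi * associationIntensity lam * (t - s)
  have h2 : (2⁻¹ : ℝ≥0∞) = ENNReal.ofReal 2⁻¹ := by
    rw [ENNReal.ofReal_inv_of_pos two_pos]; simp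
  rw [expNeg_ofReal hm, h2, ← ENNReal.ofReal_mul hm, expNeg_ofReal (by positivity)] at hint
  have hμ : μ E = ENNReal.ofReal (μ.real E) := by rw [ofReal_measureReal]
  have h3 : (2 : ℝ≥0∞) = ENNReal.ofReal 2 := by simp
  rw [hμ, h3, ← ENNReal.ofReal_one, ← ENNReal.ofReal_mul (by positivity),
    ← ENNReal.ofReal_mul (by positivity), ← ENNReal.ofReal_add (by positivity) (by positivity),
    ← ENNReal.ofReal_add (by positivity) (by positivity),
    ENNReal.ofReal_le_ofReal_iff (by positivity)] at hint
  rw [hμ]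
  apply ENNReal.ofReal_le_ofReal
  have h4 : Real.exp (-m) = Real.exp (-(m * 2⁻¹)) ^ 2 := by
    rw [← Real.exp_nat_mul]; congr 1; push_cast; ring
  have h5 : 1 - m * 2⁻¹ ≤ Real.exp (-(m * 2⁻¹)) := Real.one_sub_le_exp_neg _
  have h6 : Real.exp (-(m * 2⁻¹)) ≤ 1 := Real.exp_le_one_iff.2 (by linarith)
  rw [h4] at hint
  nlinarith

/-- Almost surely the nearest BS is unique. -/
lemma ae_unique_nearest [Fintype κ] [Countable ι] [Nonempty ι] [IsProbabilityMeasure ν]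
    (h : IsNetwork μ lam w p ν op X ξ g0 g) (hw : ∀ k, 0 ≤ w k ∧ w k ≤ 1) :
    ∀ᵐ ω ∂μ, ∀ i j, ‖X i ω‖ ^ 2 = nearestSq X ω → ‖X j ω‖ ^ 2 = nearestSq X ω → i = j := by
  have key : ∀ M : ℕ, μ {ω | nearestSq X ω < M ∧ ∃ i j, i ≠ j ∧ ‖X i ω‖ ^ 2 = nearestSq X ω ∧
      ‖X j ω‖ ^ 2 = nearestSq X ω} = 0 := by
    intro M
    set A := {ω | nearestSq X ω < M ∧ ∃ i j, i ≠ j ∧ ‖X i ω‖ ^ 2 = nearestSq X ω ∧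
      ‖X j ω‖ ^ 2 = nearestSq X ω}
    set C := Real.pi * associationIntensity lam
    -- Two nearest BSs lie in a common shell of width `1 / (n + 1)`. There are `(n + 1) M` shells
    -- below `M`, each holding two BSs with probability `O(n⁻²)`, so the total is `O(1 / n)`.
    have hb : ∀ n : ℕ, μ A ≤ ENNReal.ofReal (M * C ^ 2 / 2 * (1 / ((n : ℝ) + 1))) := by
      intro n
      have hn : (0 : ℝ) < n + 1 := by positivity
      have hsub : A ⊆ ⋃ l ∈ Finset.range ((n + 1) * M), {ω | ∃ i j, i ≠ j ∧
          ‖X i ω‖ ^ 2 ∈ Ico ((l : ℝ) / (n + 1)) ((l + 1) / (n + 1)) ∧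
          ‖X j ω‖ ^ 2 ∈ Ico ((l : ℝ) / (n + 1)) ((l + 1) / (n + 1))} := by
        rintro ω ⟨hM, i, j, hij, hi, hj⟩
        have h0 := nearestSq_nonneg (X := X) ω
        have hmem : nearestSq X ω ∈ Ico ((⌊(n + 1) * nearestSq X ω⌋₊ : ℝ) / (n + 1))
            ((⌊(n + 1) * nearestSq X ω⌋₊ + 1) / (n + 1)) := by
          constructor
          · rw [div_le_iff₀ hn, mul_comm]; exact Nat.floor_le (by positivity)
          · rw [lt_div_iff₀ hn, mul_comm]; exact Nat.lt_floor_add_one _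
        simp only [mem_iUnion]
        refine ⟨⌊(n + 1) * nearestSq X ω⌋₊, ?_, i, j, hij, hi ▸ hmem, hj ▸ hmem⟩
        rw [Finset.mem_range, Nat.floor_lt (by positivity)]
        push_cast
        gcongr
      calc μ A ≤ ∑ l ∈ Finset.range ((n + 1) * M), ENNReal.ofReal ((C * (1 / (n + 1))) ^ 2 / 2) := by
            refine (measure_mono hsub).trans ((measure_biUnion_finset_le _ _).trans ?_)
            refine Finset.sum_le_sum fun l _ => ?_
            refine (h.measure_two_in_annulus_le hw (by positivity) (by gcongr; linarith)).trans ?_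
            apply le_of_eq
            congr 3
            field_simp
            ring
        _ = _ := by
            rw [Finset.sum_const, Finset.card_range, nsmul_eq_mul,
              ← ENNReal.ofReal_natCast, ← ENNReal.ofReal_mul (by positivity)]
            congr 1
            push_cast
            field_simp
    have hlim : Tendsto (fun n : ℕ => ENNReal.ofReal (M * C ^ 2 / 2 * (1 / ((n : ℝ) + 1)))) atTop
        (𝓝 0) := by
      rw [← ENNReal.ofReal_zero]
      refine ENNReal.tendsto_ofReal ?_
      have := (tendsto_one_div_add_atTop_nhds_zero_nat (𝕜 := ℝ)).const_mul (M * C ^ 2 / 2)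
      rwa [mul_zero] at this
    exact le_antisymm (ge_of_tendsto' hlim hb) bot_le
  have key' := ae_all_iff.2 fun M => measure_eq_zero_iff_ae_notMem.1 (key M)
  filter_upwards [key'] with ω hω i j hi hj
  by_contra hij
  obtain ⟨M, hM⟩ := exists_nat_gt (nearestSq X ω)
  exact hω M ⟨hM, i, j, hij, hi, hj⟩

lemma ae_nearestSq_pos [Fintype κ] [Countable ι] [Nonempty ι] [IsProbabilityMeasure ν]
    (h : IsNetwork μ lam w p ν op X ξ g0 g)
    (hw : ∀ k, 0 ≤ w k ∧ w k ≤ 1) (hlam : 0 < associationIntensity lam) :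
    ∀ᵐ ω ∂μ, 0 < nearestSq X ω := by
  have h1 : ∀ᵐ x ∂(μ.map (nearestSq X)), 0 < x := by
    rw [h.map_nearestSq hw hlam]
    have hpos : 0 < Real.pi * associationIntensity lam := mul_pos Real.pi_pos hlam
    have := isProbabilityMeasure_expMeasure hpos
    have h2 : expMeasure (Real.pi * associationIntensity lam) (Iic 0) = 0 := by
      rw [← ofReal_measureReal, ← cdf_eq_real, cdf_expMeasure_eq hpos]
      simp
    filter_upwards [measure_eq_zero_iff_ae_notMem.1 h2] with x hx
    simpa using hx
  exact (ae_map_iff h.measurable_nearestSq.aemeasurable measurableSet_Ioi).1 h1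

omit [MeasurableSpace Ω] in
-- Only the finitely many BSs in a disc containing one of them compete for the infimum, which is
-- therefore attained.
lemma exists_eq_nearestSq [Nonempty ι] {ω : Ω} (h : ∀ m : ℕ, {i | ‖X i ω‖ ^ 2 < m}.Finite) :
    ∃ b, ‖X b ω‖ ^ 2 = nearestSq X ω := by
  obtain ⟨i0⟩ := ‹Nonempty ι›
  obtain ⟨m, hm⟩ := exists_nat_gt (‖X i0 ω‖ ^ 2)
  obtain ⟨b, hb, hmin⟩ := (h m).exists_minimalFor (fun i => ‖X i ω‖ ^ 2) _ ⟨i0, hm⟩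
  have : Nonempty ι := ⟨i0⟩
  refine ⟨b, le_antisymm (le_nearestSq_iff.2 fun i => ?_) (le_nearestSq_iff.1 le_rfl b)⟩
  by_cases hi : ‖X i ω‖ ^ 2 < m
  · exact le_of_not_gt fun hlt => (hmin hi hlt.le).not_gt hlt
  · have hb : ‖X b ω‖ ^ 2 < m := hb
    linarith

end IsNetwork

/-! ### Incomplete Gamma functions and the interference exponent -/

section IncompleteGamma

/-- The lower incomplete Gamma function `γ(1 - d, τ)`. -/
def lowerGammaOneSub (d τ : ℝ) : ℝ := ∫ u in Ioc 0 τ, u ^ (-d) * Real.exp (-u)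

/-- The interference exponent `∫_1^∞ (1 - exp (-τ v ^ (-1 / d))) dv` in closed form. -/
def tailExponent (d τ : ℝ) : ℝ := τ ^ d * lowerGammaOneSub d τ - (1 - Real.exp (-τ))

variable {d : ℝ}

lemma integrableOn_rpow_neg_mul_exp (hd1 : d < 1) :
    IntegrableOn (fun u : ℝ => u ^ (-d) * Real.exp (-u)) (Ioi 0) := by
  have := Real.GammaIntegral_convergent (s := 1 - d) (by linarith)
  refine this.congr_fun (fun u _ => ?_) measurableSet_Ioi
  simp only [sub_sub_cancel_left]
  ring

lemma lowerGammaOneSub_le (hd1 : d < 1) (τ : ℝ) :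
    lowerGammaOneSub d τ ≤ ∫ u in Ioi 0, u ^ (-d) * Real.exp (-u) :=
  setIntegral_mono_set (integrableOn_rpow_neg_mul_exp hd1)
    ((ae_restrict_iff' measurableSet_Ioi).2 (Eventually.of_forall fun u (hu : 0 < u) => by
      simp only [Pi.zero_apply]; positivity)) (Eventually.of_forall Ioc_subset_Ioi_self)

/-- Integration by parts raises the parameter from `-d` to `1 - d`, where the integrand is
integrable down to 0. -/
lemma upperGamma_neg (hd : 0 < d) (hd1 : d < 1) {τ : ℝ} (hτ : 0 < τ) :
    upperGamma (-d) τ =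
      (τ ^ (-d) * Real.exp (-τ) - ∫ u in Ioi τ, u ^ (-d) * Real.exp (-u)) / d := by
  have hint1 : IntegrableOn (fun u : ℝ => u ^ (-d) * Real.exp (-u)) (Ioi τ) :=
    (integrableOn_rpow_neg_mul_exp hd1).mono_set (Ioi_subset_Ioi hτ.le)
  have hint2 : IntegrableOn (fun u : ℝ => u ^ (-d - 1) * Real.exp (-u)) (Ioi τ) := by
    refine (hint1.const_mul τ⁻¹).mono' ?_ ?_
    · refine ContinuousOn.aestronglyMeasurable (fun u hu => ?_) measurableSet_Ioi
      have : u ≠ 0 := (hτ.trans hu).ne'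
      exact ((Real.continuousAt_rpow_const u _ (Or.inl this)).mul (by fun_prop)).continuousWithinAt
    · refine (ae_restrict_iff' measurableSet_Ioi).2 (Eventually.of_forall fun u (hu : τ < u) => ?_)
      have hu0 : 0 < u := hτ.trans hu
      rw [Real.norm_of_nonneg (by positivity), Real.rpow_sub_one hu0.ne', div_eq_mul_inv,
        mul_comm (u ^ (-d)), mul_assoc]
      have : u⁻¹ ≤ τ⁻¹ := inv_anti₀ hτ hu.le
      gcongr
  have hder : ∀ u ∈ Ici τ, HasDerivAt (fun u : ℝ => u ^ (-d) * Real.exp (-u))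
      (-d * (u ^ (-d - 1) * Real.exp (-u)) - u ^ (-d) * Real.exp (-u)) u := by
    intro u hu
    have hu0 : 0 < u := hτ.trans_le hu
    convert! (Real.hasDerivAt_rpow_const (x := u) (p := -d) (Or.inl hu0.ne')).mul
      ((hasDerivAt_neg u).exp) using 1
    ring
  have hlim : Tendsto (fun u : ℝ => u ^ (-d) * Real.exp (-u)) atTop (𝓝 0) := by
    have h1 := tendsto_rpow_neg_atTop hd
    have h2 := Real.tendsto_exp_neg_atTop_nhds_zero
    simpa using h1.mul h2
  have := integral_Ioi_of_hasDerivAt_of_tendsto' hder ((hint2.const_mul (-d)).sub hint1) hlim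
  rw [integral_sub (hint2.const_mul (-d)) hint1, integral_const_mul] at this
  rw [upperGamma, eq_div_iff hd.ne']
  linarith

/-- The recurrence `Γ(1 - d) = -d Γ(-d)` and integration by parts move both terms to parameter `1 -
d`. There the difference of the complete and the upper integral is the lower incomplete Gamma
function. -/
lemma rpow_mul_upperGamma_sub_Gamma (hd : 0 < d) (hd1 : d < 1) {τ : ℝ} (hτ : 0 < τ) :
    d * τ ^ d * (upperGamma (-d) τ - Real.Gamma (-d)) = 1 + tailExponent d τ := by
  have hΓ : Real.Gamma (1 - d) = -d * Real.Gamma (-d) := by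
    have := Real.Gamma_add_one (s := -d) (by linarith)
    rwa [neg_add_eq_sub] at this
  have hΓ2 : Real.Gamma (1 - d) = ∫ u in Ioi 0, u ^ (-d) * Real.exp (-u) := by
    rw [Real.Gamma_eq_integral (by linarith)]
    refine setIntegral_congr_fun measurableSet_Ioi fun u _ => ?_
    simp only [sub_sub_cancel_left]
    ring
  have hsplit : ∫ u in Ioi 0, u ^ (-d) * Real.exp (-u) =
      lowerGammaOneSub d τ + ∫ u in Ioi τ, u ^ (-d) * Real.exp (-u) := by
    rw [lowerGammaOneSub, ← setIntegral_union (Ioc_disjoint_Ioi le_rfl) measurableSet_Ioi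
      ((integrableOn_rpow_neg_mul_exp hd1).mono_set Ioc_subset_Ioi_self)
      ((integrableOn_rpow_neg_mul_exp hd1).mono_set (Ioi_subset_Ioi hτ.le)),
      Ioc_union_Ioi_eq_Ioi hτ.le]
  rw [upperGamma_neg hd hd1 hτ, tailExponent]
  have h1 : τ ^ d * τ ^ (-d) = 1 := by rw [← Real.rpow_add hτ, add_neg_cancel, Real.rpow_zero]
  have h2 : d * ((τ ^ (-d) * Real.exp (-τ) - ∫ u in Ioi τ, u ^ (-d) * Real.exp (-u)) / d
      - Real.Gamma (-d)) = τ ^ (-d) * Real.exp (-τ) + lowerGammaOneSub d τ := by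
    rw [mul_sub, mul_div_cancel₀ _ hd.ne']
    linarith
  rw [mul_comm d, mul_assoc, h2, mul_add, ← mul_assoc, h1]
  ring

lemma setLIntegral_exp_neg {z : ℝ} (hz : 0 ≤ z) :
    ∫⁻ u in Ioc 0 z, ENNReal.ofReal (Real.exp (-u)) = ENNReal.ofReal (1 - Real.exp (-z)) := by
  have hi : IntegrableOn (fun u : ℝ => Real.exp (-u)) (Ioc 0 z) :=
    (Real.continuous_exp.comp continuous_neg).integrableOn_Ioc
  rw [← ofReal_integral_eq_lintegral_ofReal hi (Eventually.of_forall fun u => (Real.exp_pos _).le),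
    ← intervalIntegral.integral_of_le hz, intervalIntegral.integral_comp_neg (fun u => Real.exp u),
    integral_exp]
  simp

lemma integral_Ioc_exp_mul (hd1 : d < 1) {τ : ℝ} (hτ : 0 < τ) :
    IntegrableOn (fun u : ℝ => Real.exp (-u) * ((τ / u) ^ d - 1)) (Ioc 0 τ) ∧
    ∫ u in Ioc 0 τ, Real.exp (-u) * ((τ / u) ^ d - 1) = tailExponent d τ := by
  have hi : IntegrableOn (fun u : ℝ => Real.exp (-u)) (Ioc 0 τ) :=
    (Real.continuous_exp.comp continuous_neg).integrableOn_Ioc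
  have hi2 : IntegrableOn (fun u : ℝ => u ^ (-d) * Real.exp (-u)) (Ioc 0 τ) :=
    (integrableOn_rpow_neg_mul_exp hd1).mono_set Ioc_subset_Ioi_self
  have e : EqOn (fun u : ℝ => τ ^ d * (u ^ (-d) * Real.exp (-u)) - Real.exp (-u))
      (fun u : ℝ => Real.exp (-u) * ((τ / u) ^ d - 1)) (Ioc 0 τ) := by
    intro u hu
    simp only
    rw [Real.div_rpow hτ.le hu.1.le, Real.rpow_neg hu.1.le]
    ring
  refine ⟨IntegrableOn.congr_fun ((hi2.const_mul _).sub hi) e measurableSet_Ioc, ?_⟩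
  rw [← setIntegral_congr_fun measurableSet_Ioc e, integral_sub (hi2.const_mul _) hi,
    integral_const_mul, tailExponent, lowerGammaOneSub]
  congr 1
  rw [← intervalIntegral.integral_of_le hτ.le,
    intervalIntegral.integral_comp_neg (fun u => Real.exp u), integral_exp]
  simp

lemma one_sub_expNeg_ofReal {x : ℝ} (hx : 0 ≤ x) :
    1 - expNeg (ENNReal.ofReal x) = ENNReal.ofReal (1 - Real.exp (-x)) := by
  rw [expNeg_ofReal hx, ENNReal.ofReal_sub _ (Real.exp_pos _).le, ENNReal.ofReal_one]

lemma tailExponent_nonneg (hd : 0 < d) (hd1 : d < 1) {τ : ℝ} (hτ : 0 < τ) :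
    0 ≤ tailExponent d τ := by
  rw [← (integral_Ioc_exp_mul hd1 hτ).2]
  refine setIntegral_nonneg measurableSet_Ioc fun u hu => ?_
  have : 1 ≤ (τ / u) ^ d := Real.one_le_rpow ((one_le_div hu.1).2 hu.2) hd.le
  have : 0 ≤ (τ / u) ^ d - 1 := by linarith
  positivity

/-- Layer-cake: write `1 - exp (-z) = ∫_0^z exp (-u) du` and exchange the integrals. For fixed `u`
the admissible `y` run over `(r, r (τ / u) ^ d]`, which is nonempty only for `u < τ` and has length
`r ((τ / u) ^ d - 1)`. -/
lemma lintegral_tailExponent (hd : 0 < d) (hd1 : d < 1) {τ r : ℝ} (hτ : 0 < τ) (hr : 0 < r) :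
    ∫⁻ y in Ioi r, (1 - expNeg (ENNReal.ofReal (τ * (y / r) ^ (-d⁻¹)))) =
      ENNReal.ofReal (r * tailExponent d τ) := by
  have e1 : ∀ y ∈ Ioi r, 1 - expNeg (ENNReal.ofReal (τ * (y / r) ^ (-d⁻¹))) =
      ∫⁻ u in Ioi 0, {q : ℝ × ℝ | q.2 ≤ τ * (q.1 / r) ^ (-d⁻¹)}.indicator
        (fun q => ENNReal.ofReal (Real.exp (-q.2))) (y, u) := by
    intro y hy
    have hy0 : 0 < y := hr.trans hy
    have hz : 0 ≤ τ * (y / r) ^ (-d⁻¹) := by positivity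
    rw [one_sub_expNeg_ofReal hz, ← setLIntegral_exp_neg hz, ← Ioi_inter_Iic, inter_comm,
      ← Measure.restrict_restrict measurableSet_Iic, ← lintegral_indicator measurableSet_Iic]
    rfl
  have hms : MeasurableSet {q : ℝ × ℝ | q.2 ≤ τ * (q.1 / r) ^ (-d⁻¹)} :=
    measurableSet_le (by fun_prop) (by fun_prop)
  have hmf : Measurable ({q : ℝ × ℝ | q.2 ≤ τ * (q.1 / r) ^ (-d⁻¹)}.indicator
      (fun q => ENNReal.ofReal (Real.exp (-q.2)))) := Measurable.indicator (by fun_prop) hms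
  rw [setLIntegral_congr_fun measurableSet_Ioi e1, lintegral_lintegral_swap
    (f := fun y u => {q : ℝ × ℝ | q.2 ≤ τ * (q.1 / r) ^ (-d⁻¹)}.indicator
      (fun q => ENNReal.ofReal (Real.exp (-q.2))) (y, u)) hmf.aemeasurable]
  have e2 : ∀ u ∈ Ioi (0 : ℝ), ∫⁻ y in Ioi r, {q : ℝ × ℝ | q.2 ≤ τ * (q.1 / r) ^ (-d⁻¹)}.indicator
        (fun q => ENNReal.ofReal (Real.exp (-q.2))) (y, u) =
      (Ioc 0 τ).indicator (fun u => ENNReal.ofReal (r * (Real.exp (-u) * ((τ / u) ^ d - 1)))) u := by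
    intro u hu
    have hu : 0 < u := hu
    have h1 : ∀ y ∈ Ioi r, {q : ℝ × ℝ | q.2 ≤ τ * (q.1 / r) ^ (-d⁻¹)}.indicator
        (fun q => ENNReal.ofReal (Real.exp (-q.2))) (y, u) =
        (Iic (r * (τ / u) ^ d)).indicator (fun _ => ENNReal.ofReal (Real.exp (-u))) y := by
      intro y hy
      have hy0 : 0 < y := hr.trans hy
      have hiff : u ≤ τ * (y / r) ^ (-d⁻¹) ↔ y ≤ r * (τ / u) ^ d := by
        rw [Real.rpow_neg (by positivity), ← div_eq_mul_inv, le_div_iff₀ (by positivity),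
          mul_comm u, ← le_div_iff₀ hu, ← div_le_iff₀' hr,
          Real.rpow_inv_le_iff_of_pos (by positivity) (by positivity) hd]
      by_cases h : u ≤ τ * (y / r) ^ (-d⁻¹)
      · have h' := hiff.1 h
        simp [indicator, h, h']
      · have h' := mt hiff.2 h
        simp [indicator, h, h']
    rw [setLIntegral_congr_fun measurableSet_Ioi h1, lintegral_indicator measurableSet_Iic,
      setLIntegral_const, Measure.restrict_apply measurableSet_Iic, inter_comm, Ioi_inter_Iic,
      Real.volume_Ioc, ← ENNReal.ofReal_mul (Real.exp_pos _).le]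
    by_cases h : u ≤ τ
    · rw [indicator_of_mem (show u ∈ Ioc 0 τ from ⟨hu, h⟩)]
      congr 1; ring
    · rw [indicator_of_notMem (fun hh => h hh.2)]
      apply ENNReal.ofReal_of_nonpos
      have h3 : (τ / u) ^ d ≤ 1 := Real.rpow_le_one (by positivity)
        ((div_le_one hu).2 (not_le.1 h).le) hd.le
      have : r * (τ / u) ^ d - r ≤ 0 := by nlinarith
      exact mul_nonpos_of_nonneg_of_nonpos (Real.exp_pos _).le this
  rw [setLIntegral_congr_fun measurableSet_Ioi e2, lintegral_indicator measurableSet_Ioc,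
    Measure.restrict_restrict measurableSet_Ioc, inter_eq_left.2 Ioc_subset_Ioi_self,
    ← ofReal_integral_eq_lintegral_ofReal ((integral_Ioc_exp_mul hd1 hτ).1.const_mul r),
    integral_const_mul, (integral_Ioc_exp_mul hd1 hτ).2]
  refine (ae_restrict_iff' measurableSet_Ioc).2 (Eventually.of_forall fun u hu => ?_)
  have : 1 ≤ (τ / u) ^ d := Real.one_le_rpow ((one_le_div hu.1).2 hu.2) hd.le
  have : 0 ≤ (τ / u) ^ d - 1 := by linarith
  simp only [Pi.zero_apply]
  positivity

end IncompleteGamma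

/-! ### The coefficient `β` as a mean interference exponent -/

section Beta

variable {T p α : ℝ} {ν : Measure ℝ}

/-- The Gamma identity with `d = 2 / α` and `τ = T x / p`; averaged over `ν` it shows that `β - 1`
is the mean of `tailExponent`. -/
lemma betaIntegrand_eq (hT : 0 < T) (hp : 0 < p) (hα : 2 < α) {x : ℝ} (hx : 0 < x) :
    2 * (T / p) ^ (2 / α) / α * betaIntegrand T p α x = 1 + tailExponent (2 / α) (T * x / p) := by
  have hα0 : 0 < α := by linarith
  rw [← rpow_mul_upperGamma_sub_Gamma (by positivity) ((div_lt_one hα0).2 hα) (by positivity),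
    betaIntegrand, show T * x / p = T / p * x by ring, Real.mul_rpow (by positivity) hx.le, neg_div]
  ring

/-- Dominated by `τ ^ d Γ(1 - d)`, a multiple of `x ^ (2 / α)`; this is where the moment assumption
enters. Measurability in `x` is read off the integral representation at `r = 1`. -/
lemma integrable_tailExponent [IsFiniteMeasure ν] (hT : 0 < T) (hp : 0 < p) (hα : 2 < α)
    (hν_pos : ∀ᵐ x ∂ν, 0 < x) (hν_int : Integrable (fun x : ℝ => x ^ (2 / α)) ν) :
    Integrable (fun x => tailExponent (2 / α) (T * x / p)) ν := by
  have hα0 : 0 < α := by linarith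
  have hd : 0 < 2 / α := by positivity
  have hd1 : 2 / α < 1 := (div_lt_one hα0).2 hα
  set C := ∫ u in Ioi 0, u ^ (-(2 / α)) * Real.exp (-u)
  have hm : Measurable fun x : ℝ => (∫⁻ y in Ioi (1 : ℝ),
      (1 - expNeg (ENNReal.ofReal (T * x / p * (y / 1) ^ (-(2 / α)⁻¹))))).toReal := by
    refine Measurable.ennreal_toReal (Measurable.lintegral_prod_right' (f := fun q : ℝ × ℝ =>
      1 - expNeg (ENNReal.ofReal (T * q.1 / p * (q.2 / 1) ^ (-(2 / α)⁻¹)))) ?_)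
    fun_prop
  have hme : AEStronglyMeasurable (fun x => tailExponent (2 / α) (T * x / p)) ν := by
    refine hm.aestronglyMeasurable.congr ?_
    filter_upwards [hν_pos] with x hx
    rw [lintegral_tailExponent hd hd1 (by positivity) one_pos, one_mul,
      ENNReal.toReal_ofReal (tailExponent_nonneg hd hd1 (by positivity))]
  refine (hν_int.const_mul ((T / p) ^ (2 / α) * C)).mono' hme ?_
  filter_upwards [hν_pos] with x hx
  have hτ : 0 < T * x / p := by positivity
  rw [Real.norm_of_nonneg (tailExponent_nonneg hd hd1 hτ), tailExponent]
  have h1 : Real.exp (-(T * x / p)) ≤ 1 := Real.exp_le_one_iff.2 (by linarith)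
  have h2 := lowerGammaOneSub_le hd1 (T * x / p)
  have h3 : (T * x / p) ^ (2 / α) = (T / p) ^ (2 / α) * x ^ (2 / α) := by
    rw [← Real.mul_rpow (by positivity) hx.le]; congr 1; ring
  calc _ ≤ (T * x / p) ^ (2 / α) * lowerGammaOneSub (2 / α) (T * x / p) := by linarith
    _ ≤ (T * x / p) ^ (2 / α) * C := by gcongr
    _ = _ := by rw [h3]; ring

lemma integrable_betaIntegrand [IsFiniteMeasure ν] (hT : 0 < T) (hp : 0 < p) (hα : 2 < α)
    (hν_pos : ∀ᵐ x ∂ν, 0 < x) (hν_int : Integrable (fun x : ℝ => x ^ (2 / α)) ν) :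
    Integrable (betaIntegrand T p α) ν := by
  have hc : 2 * (T / p) ^ (2 / α) / α ≠ 0 := by
    have : 0 < α := by linarith
    positivity
  refine (((integrable_const 1).add (integrable_tailExponent hT hp hα hν_pos hν_int)).const_mul
    (2 * (T / p) ^ (2 / α) / α)⁻¹).congr ?_
  filter_upwards [hν_pos] with x hx
  rw [Pi.add_apply, ← betaIntegrand_eq hT hp hα hx, inv_mul_cancel_left₀ hc]

lemma betaCoeff_eq [IsProbabilityMeasure ν] (hT : 0 < T) (hp : 0 < p) (hα : 2 < α)
    (hν_pos : ∀ᵐ x ∂ν, 0 < x) (hν_int : Integrable (fun x : ℝ => x ^ (2 / α)) ν) :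
    betaCoeff T p α ν = 1 + ∫ x, tailExponent (2 / α) (T * x / p) ∂ν := by
  rw [betaCoeff, ← integral_const_mul, integral_congr_ae (hν_pos.mono fun x hx =>
    betaIntegrand_eq hT hp hα hx), integral_add (integrable_const _)
    (integrable_tailExponent hT hp hα hν_pos hν_int)]
  simp

lemma one_le_betaCoeff [IsProbabilityMeasure ν] (hT : 0 < T) (hp : 0 < p) (hα : 2 < α)
    (hν_pos : ∀ᵐ x ∂ν, 0 < x) (hν_int : Integrable (fun x : ℝ => x ^ (2 / α)) ν) :
    1 ≤ betaCoeff T p α ν := by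
  rw [betaCoeff_eq hT hp hα hν_pos hν_int, le_add_iff_nonneg_right]
  refine integral_nonneg_of_ae (hν_pos.mono fun x hx => ?_)
  have hα0 : 0 < α := by linarith
  exact tailExponent_nonneg (by positivity) ((div_lt_one hα0).2 hα) (by positivity)

/-- The exponent of the Laplace transform of the interference from BSs at squared distance at
least `r`. -/
lemma lintegral_one_sub_laplaceTransform [IsProbabilityMeasure ν] (hT : 0 < T) (hp : 0 < p)
    (hα : 2 < α) (hν_pos : ∀ᵐ x ∂ν, 0 < x) (hν_int : Integrable (fun x : ℝ => x ^ (2 / α)) ν)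
    {r : ℝ} (hr : 0 < r) :
    ∫⁻ y in Ici r, (1 - laplaceTransform ν
      (ENNReal.ofReal (T / p * r ^ (α / 2)) * ENNReal.ofReal (y ^ (-α / 2)))) =
      ENNReal.ofReal (r * (betaCoeff T p α ν - 1)) := by
  have hα0 : 0 < α := by linarith
  have hd : 0 < 2 / α := by positivity
  have hd1 : 2 / α < 1 := (div_lt_one hα0).2 hα
  rw [setLIntegral_congr Ioi_ae_eq_Ici.symm]
  have e1 : ∀ y ∈ Ioi r, 1 - laplaceTransform ν
      (ENNReal.ofReal (T / p * r ^ (α / 2)) * ENNReal.ofReal (y ^ (-α / 2))) =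
      ∫⁻ x, (1 - expNeg (ENNReal.ofReal (T * x / p * (y / r) ^ (-(2 / α)⁻¹)))) ∂ν := by
    intro y hy
    have hy0 : 0 < y := hr.trans hy
    have h1 : ∀ x : ℝ, ENNReal.ofReal (T / p * r ^ (α / 2)) * ENNReal.ofReal (y ^ (-α / 2)) *
        ENNReal.ofReal x = ENNReal.ofReal (T * x / p * (y / r) ^ (-(2 / α)⁻¹)) := by
      intro x
      rw [← ENNReal.ofReal_mul (by positivity), ← ENNReal.ofReal_mul (by positivity),
        Real.div_rpow hy0.le hr.le, inv_div, Real.rpow_neg hr.le, neg_div]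
      congr 1
      field_simp
    rw [lintegral_sub' (by fun_prop) _ (Eventually.of_forall fun x => expNeg_le_one _)]
    · simp only [lintegral_one, measure_univ, laplaceTransform]
      simp_rw [h1]
    · exact ((lintegral_mono fun x => expNeg_le_one _).trans_lt (by simp)).ne
  rw [setLIntegral_congr_fun measurableSet_Ioi e1, lintegral_lintegral_swap (by fun_prop),
    lintegral_congr_ae (hν_pos.mono fun x hx => lintegral_tailExponent hd hd1
      (show 0 < T * x / p by positivity) hr),
    ← ofReal_integral_eq_lintegral_ofReal
      ((integrable_tailExponent hT hp hα hν_pos hν_int).const_mul r), integral_const_mul,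
    betaCoeff_eq hT hp hα hν_pos hν_int, add_sub_cancel_left]
  filter_upwards [hν_pos] with x hx
  exact mul_nonneg hr.le (tailExponent_nonneg hd hd1 (by positivity))

end Beta

/-! ### Conditioning on the nearest distance by shrinking intervals -/

/-- If the product formula `E[Y s t; s ≤ R < t] = P(s ≤ R < t) K s t` holds for all intervals, it
passes to the limit of intervals shrinking to `R`. -/
lemma lintegral_eq_of_interval_factorization {Ω : Type*} [MeasurableSpace Ω] {μ : Measure Ω}
    [IsProbabilityMeasure μ] {R : Ω → ℝ} (hR : Measurable R) (hR0 : ∀ ω, 0 ≤ R ω)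
    {Y : ℝ → ℝ → Ω → ℝ≥0∞} {K : ℝ → ℝ → ℝ≥0∞} {Y0 : Ω → ℝ≥0∞} {K0 : ℝ → ℝ≥0∞}
    (hYm : ∀ s t, Measurable (Y s t)) (hY1 : ∀ s t ω, Y s t ω ≤ 1) (hK1 : ∀ s t, K s t ≤ 1)
    (hfac : ∀ s t, 0 ≤ s → s < t →
      ∫⁻ ω in {ω | s ≤ R ω ∧ R ω < t}, Y s t ω ∂μ = μ {ω | s ≤ R ω ∧ R ω < t} * K s t)
    (hY : ∀ᵐ ω ∂μ, ∀ s t : ℕ → ℝ, (∀ n, s n ≤ R ω) → (∀ n, R ω < t n) →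
      Tendsto s atTop (𝓝 (R ω)) → Tendsto t atTop (𝓝 (R ω)) →
      Tendsto (fun n => Y (s n) (t n) ω) atTop (𝓝 (Y0 ω)))
    (hK : ∀ᵐ ω ∂μ, ∀ s t : ℕ → ℝ, (∀ n, 0 ≤ s n) → (∀ n, s n ≤ R ω) → (∀ n, R ω < t n) →
      Tendsto s atTop (𝓝 (R ω)) → Tendsto t atTop (𝓝 (R ω)) →
      Tendsto (fun n => K (s n) (t n)) atTop (𝓝 (K0 (R ω)))) :
    ∫⁻ ω, Y0 ω ∂μ = ∫⁻ ω, K0 (R ω) ∂μ := by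
  -- Index of the grid cell of mesh `1 / (n + 1)` containing `R`. The random endpoints depend on `ω`
  -- only through this integer, so the product formula can be summed over the cells.
  let J : ℕ → Ω → ℕ := fun n ω => ⌊((n : ℝ) + 1) * R ω⌋₊
  have hJ : ∀ n, Measurable (J n) := fun n => Nat.measurable_floor.comp (by fun_prop)
  let s : ℕ → ℕ → ℝ := fun n j => j / ((n : ℝ) + 1)
  let t : ℕ → ℕ → ℝ := fun n j => (j + 1) / ((n : ℝ) + 1)
  have hn : ∀ n : ℕ, (0 : ℝ) < n + 1 := fun n => by positivity
  have hs0 : ∀ n j, 0 ≤ s n j := fun n j => by positivity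
  have hst : ∀ n j, s n j < t n j := fun n j => by
    simp only [s, t]; gcongr; linarith
  have hfib : ∀ n j, J n ⁻¹' {j} = {ω | s n j ≤ R ω ∧ R ω < t n j} := by
    intro n j
    ext ω
    have := hn n
    simp only [J, s, t, mem_preimage, mem_singleton_iff, mem_ofPred_eq]
    rw [Nat.floor_eq_iff (mul_nonneg this.le (hR0 ω)), div_le_iff₀' this, lt_div_iff₀' this]
  have hmem : ∀ n ω, s n (J n ω) ≤ R ω ∧ R ω < t n (J n ω) := fun n ω => by
    have : ω ∈ J n ⁻¹' {J n ω} := rfl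
    rw [hfib] at this
    exact this
  have heq : ∀ n, ∫⁻ ω, Y (s n (J n ω)) (t n (J n ω)) ω ∂μ =
      ∫⁻ ω, K (s n (J n ω)) (t n (J n ω)) ∂μ := by
    intro n
    have hpart : ∀ f : Ω → ℝ≥0∞, ∫⁻ ω, f ω ∂μ = ∑' j, ∫⁻ ω in J n ⁻¹' {j}, f ω ∂μ := by
      intro f
      have hU : ⋃ j, J n ⁻¹' {j} = univ := by
        ext ω; simp
      rw [← lintegral_iUnion (fun j => hJ n (measurableSet_singleton j))
        (fun i j hij => Disjoint.preimage _ (by simpa using hij)), hU, setLIntegral_univ]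
    rw [hpart, hpart]
    refine tsum_congr fun j => ?_
    have hmj := hJ n (measurableSet_singleton j)
    have h1 : ∫⁻ ω in J n ⁻¹' {j}, Y (s n (J n ω)) (t n (J n ω)) ω ∂μ =
        ∫⁻ ω in J n ⁻¹' {j}, Y (s n j) (t n j) ω ∂μ :=
      setLIntegral_congr_fun hmj fun ω (hω : J n ω = j) => by simp only [hω]
    have h2 : ∫⁻ ω in J n ⁻¹' {j}, K (s n (J n ω)) (t n (J n ω)) ∂μ =
        ∫⁻ _ in J n ⁻¹' {j}, K (s n j) (t n j) ∂μ :=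
      setLIntegral_congr_fun hmj fun ω (hω : J n ω = j) => by simp only [hω]
    rw [h1, h2, setLIntegral_const, hfib, hfac _ _ (hs0 n j) (hst n j), mul_comm]
  have hlim1 : ∀ ω, Tendsto (fun n => s n (J n ω)) atTop (𝓝 (R ω)) := by
    intro ω
    have h0 : Tendsto (fun n : ℕ => R ω - 1 / ((n : ℝ) + 1)) atTop (𝓝 (R ω)) := by
      simpa using tendsto_const_nhds.sub (tendsto_one_div_add_atTop_nhds_zero_nat (𝕜 := ℝ))
    refine tendsto_of_tendsto_of_tendsto_of_le_of_le h0 tendsto_const_nhds (fun n => ?_)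
      (fun n => (hmem n ω).1)
    have := (hmem n ω).2
    simp only [s, t, add_div] at this ⊢
    linarith
  have hlim2 : ∀ ω, Tendsto (fun n => t n (J n ω)) atTop (𝓝 (R ω)) := by
    intro ω
    have := (hlim1 ω).add (tendsto_one_div_add_atTop_nhds_zero_nat (𝕜 := ℝ))
    rw [add_zero] at this
    refine this.congr fun n => ?_
    simp only [s, t, add_div]
  have hT1 : Tendsto (fun n => ∫⁻ ω, Y (s n (J n ω)) (t n (J n ω)) ω ∂μ) atTop
      (𝓝 (∫⁻ ω, Y0 ω ∂μ)) := by
    refine tendsto_lintegral_of_dominated_convergence (fun _ => 1) (fun n => ?_)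
      (fun n => Eventually.of_forall fun ω => hY1 _ _ _) (by simp) ?_
    · exact (measurable_from_prod_countable_right (f := fun q : ℕ × Ω => Y (s n q.1) (t n q.1) q.2)
        (fun j => hYm (s n j) (t n j))).comp ((hJ n).prodMk measurable_id)
    · filter_upwards [hY] with ω hω
      exact hω _ _ (fun n => (hmem n ω).1) (fun n => (hmem n ω).2) (hlim1 ω) (hlim2 ω)
  have hT2 : Tendsto (fun n => ∫⁻ ω, K (s n (J n ω)) (t n (J n ω)) ∂μ) atTop
      (𝓝 (∫⁻ ω, K0 (R ω) ∂μ)) := by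
    refine tendsto_lintegral_of_dominated_convergence (fun _ => 1) (fun n => ?_)
      (fun n => Eventually.of_forall fun ω => hK1 _ _) (by simp) ?_
    · exact (Measurable.of_discrete (f := fun j : ℕ => K (s n j) (t n j))).comp (hJ n)
    · filter_upwards [hK] with ω hω
      exact hω _ _ (fun n => hs0 _ _) (fun n => (hmem n ω).1) (fun n => (hmem n ω).2)
        (hlim1 ω) (hlim2 ω)
  simp_rw [heq] at hT1
  exact tendsto_nhds_unique hT1 hT2

/-- The sum of the received powers from the active BSs that are not nearest. -/
def beyondSum {Ω ι : Type*} (p : ℝ) (X : ι → Ω → Plane) (ξ : ι → Ω → Bool) (g : ι → Ω → ℝ)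
    (b : ℝ → ℝ≥0∞) (ω : Ω) : ℝ≥0∞ :=
  ∑' i, if nearestSq X ω < ‖X i ω‖ ^ 2 ∧ ξ i ω = true then
    b (‖X i ω‖ ^ 2) * ENNReal.ofReal (p * g i ω) else 0

/-- The path loss of a link of squared length `y`. -/
def pathLoss (α y : ℝ) : ℝ≥0∞ := ENNReal.ofReal (y ^ (-α / 2))

/-- The factor by which noise and interference are weighted when the squared distance to the
serving BS is `s`. -/
def threshold (T p α s : ℝ) : ℝ≥0∞ := ENNReal.ofReal (T / p * s ^ (α / 2))

@[fun_prop]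
lemma measurable_pathLoss (α : ℝ) : Measurable (pathLoss α) := by
  unfold pathLoss; fun_prop

@[fun_prop]
lemma measurable_threshold (T p α : ℝ) : Measurable (threshold T p α) := by
  unfold threshold; fun_prop

lemma continuous_threshold {T p α : ℝ} (hα : 2 < α) : Continuous (threshold T p α) :=
  ENNReal.continuous_ofReal.comp (continuous_const.mul (Real.continuous_rpow_const (by linarith)))

lemma threshold_mono {T p α : ℝ} (hT : 0 < T) (hp : 0 < p) (hα : 2 < α) {s r : ℝ} (hs : 0 ≤ s)
    (hsr : s ≤ r) : threshold T p α s ≤ threshold T p α r :=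
  ENNReal.ofReal_le_ofReal (by
    have := Real.rpow_le_rpow hs hsr (show 0 ≤ α / 2 by linarith)
    gcongr)

lemma threshold_pos {T p α : ℝ} (hT : 0 < T) (hp : 0 < p) {r : ℝ} (hr : 0 < r) :
    0 < threshold T p α r := ENNReal.ofReal_pos.2 (by positivity)

lemma continuous_laplaceTransform (ν : Measure ℝ) [IsProbabilityMeasure ν] :
    Continuous (laplaceTransform ν) := by
  rw [continuous_iff_seqContinuous]
  intro a a0 ha
  refine tendsto_lintegral_of_dominated_convergence (fun _ => 1) (fun n => by fun_prop)
    (fun n => Eventually.of_forall fun x => expNeg_le_one _) (by simp)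
    (Eventually.of_forall fun x => ?_)
  exact (continuous_expNeg.tendsto _).comp
    (ENNReal.Tendsto.mul_const ha (Or.inr ENNReal.ofReal_ne_top))

lemma laplaceTransform_anti (ν : Measure ℝ) : Antitone (laplaceTransform ν) := fun a b hab =>
  lintegral_mono fun x => antitone_expNeg (by gcongr)

/-- The Laplace transform at `threshold s` of the noise and of the interference from squared
distances at least `t`. -/
def farLaplace (T p α σ lamI : ℝ) (ν : Measure ℝ) (s t : ℝ) : ℝ≥0∞ :=
  expNeg (threshold T p α s * ENNReal.ofReal (σ ^ 2) + ENNReal.ofReal (Real.pi * lamI) *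
    ∫⁻ y in Ici t, (1 - laplaceTransform ν (threshold T p α s * pathLoss α y)))

/-- Since `s n ≤ r < t n`, the weight and the domain are both smaller than at `r`, so the integrand
at `r` on `[r, ∞)` dominates. Its integral is finite by the closed form. -/
lemma tendsto_farLaplace {T p α σ lamI : ℝ} {ν : Measure ℝ} [IsProbabilityMeasure ν] (hT : 0 < T)
    (hp : 0 < p) (hα : 2 < α) (hν_pos : ∀ᵐ x ∂ν, 0 < x)
    (hν_int : Integrable (fun x : ℝ => x ^ (2 / α)) ν) {r : ℝ} (hr : 0 < r) {s t : ℕ → ℝ}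
    (hs0 : ∀ n, 0 ≤ s n) (hsr : ∀ n, s n ≤ r) (hrt : ∀ n, r < t n)
    (hs : Tendsto s atTop (𝓝 r)) (ht : Tendsto t atTop (𝓝 r)) :
    Tendsto (fun n => farLaplace T p α σ lamI ν (s n) (t n)) atTop
      (𝓝 (farLaplace T p α σ lamI ν r r)) := by
  have hθ : Tendsto (fun n => threshold T p α (s n)) atTop (𝓝 (threshold T p α r)) :=
    ((continuous_threshold hα).tendsto r).comp hs
  refine (continuous_expNeg.tendsto _).comp (Tendsto.add ?_ ?_)
  · exact ENNReal.Tendsto.mul_const hθ (Or.inr ENNReal.ofReal_ne_top)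
  · refine ENNReal.Tendsto.const_mul ?_ (Or.inr ENNReal.ofReal_ne_top)
    have hm : ∀ c : ℝ≥0∞, Measurable fun y => 1 - laplaceTransform ν (c * pathLoss α y) := fun c =>
      measurable_const.sub ((measurable_laplaceTransform ν).comp (by fun_prop))
    simp_rw [← lintegral_indicator measurableSet_Ici]
    refine tendsto_lintegral_of_dominated_convergence ((Ici r).indicator fun y =>
      1 - laplaceTransform ν (threshold T p α r * pathLoss α y))
      (fun n => (hm _).indicator measurableSet_Ici) (fun n => Eventually.of_forall fun y => ?_) ?_ ?_
    · refine (indicator_le_indicator_of_subset (Ici_subset_Ici.2 (hrt n).le) (fun _ => bot_le) y).trans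
        (indicator_le_indicator ?_)
      refine tsub_le_tsub_left (laplaceTransform_anti ν ?_) _
      gcongr
      exact threshold_mono hT hp hα (hs0 n) (hsr n)
    · rw [lintegral_indicator measurableSet_Ici]
      refine ne_of_eq_of_ne (lintegral_one_sub_laplaceTransform hT hp hα hν_pos hν_int hr) ?_
      exact ENNReal.ofReal_ne_top
    · have hne : ∀ᵐ y : ℝ, y ≠ r := by simp [ae_iff]
      filter_upwards [hne] with y hy
      rcases lt_or_gt_of_ne hy with hy | hy
      · have h1 : ∀ n, y ∉ Ici (t n) := fun n => by simpa using hy.trans (hrt n)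
        rw [indicator_of_notMem (by simpa using hy)]
        simp_rw [indicator_of_notMem (h1 _)]
        exact tendsto_const_nhds
      · rw [indicator_of_mem (by exact hy.le)]
        have h2 : ∀ᶠ n in atTop, t n ≤ y := (ht.eventually (gt_mem_nhds hy)).mono fun n h => h.le
        refine Tendsto.congr' (f₁ := fun n =>
          1 - laplaceTransform ν (threshold T p α (s n) * pathLoss α y)) ?_ ?_
        · filter_upwards [h2] with n hn
          rw [indicator_of_mem (by exact hn)]
        · refine ENNReal.Tendsto.sub tendsto_const_nhds
            (((continuous_laplaceTransform ν).tendsto _).comp ?_) (Or.inl ENNReal.one_ne_top)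
          exact ENNReal.Tendsto.mul_const hθ (Or.inr ENNReal.ofReal_ne_top)

lemma farLaplace_self {T p α σ lamI : ℝ} {ν : Measure ℝ} [IsProbabilityMeasure ν] (hT : 0 < T)
    (hp : 0 < p) (hα : 2 < α) (hlamI : 0 ≤ lamI) (hν_pos : ∀ᵐ x ∂ν, 0 < x)
    (hν_int : Integrable (fun x : ℝ => x ^ (2 / α)) ν) {r : ℝ} (hr : 0 < r) :
    farLaplace T p α σ lamI ν r r = ENNReal.ofReal (Real.exp
      (-(coeffB T p σ * r ^ (α / 2) + Real.pi * lamI * (betaCoeff T p α ν - 1) * r))) := by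
  have hβ := one_le_betaCoeff hT hp hα hν_pos hν_int
  have hβ' : 0 ≤ betaCoeff T p α ν - 1 := by linarith
  unfold farLaplace threshold pathLoss
  rw [lintegral_one_sub_laplaceTransform hT hp hα hν_pos hν_int hr,
    ← ENNReal.ofReal_mul (by positivity), ← ENNReal.ofReal_mul (by positivity),
    ← ENNReal.ofReal_add (by positivity) (by positivity), expNeg_ofReal (by positivity), coeffB]
  congr 3
  ring

namespace IsNetwork

variable {Ω κ ι : Type*} [MeasurableSpace Ω] {μ : Measure Ω} [IsProbabilityMeasure μ]
  {lam : κ → ℝ≥0} {w : κ → ℝ} {T p α σ : ℝ} {ν : Measure ℝ}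
  {op : ι → κ} {X : ι → Ω → Plane} {ξ : ι → Ω → Bool} {g0 : Ω → ℝ} {g : ι → Ω → ℝ}

/-- The far factor depends on `s` only through the weight and on `t` only through the range, not on
the void radius `u`. Subtracting the void formula at `u = t` from that at `u = s` therefore
multiplies the same factor by `P(s ≤ R < t)`. -/
lemma setLIntegral_farSum [Fintype κ] [Countable ι] [Nonempty ι] [IsProbabilityMeasure ν]
    (h : IsNetwork μ lam w p ν op X ξ g0 g)
    (hw : ∀ k, 0 ≤ w k ∧ w k ≤ 1) {s t : ℝ} (hs : 0 ≤ s) (hst : s < t) :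
    ∫⁻ ω in {ω | s ≤ nearestSq X ω ∧ nearestSq X ω < t},
      expNeg (threshold T p α s *
        (ENNReal.ofReal (σ ^ 2) + farSum p X ξ g (pathLoss α) t ω)) ∂μ =
      μ {ω | s ≤ nearestSq X ω ∧ nearestSq X ω < t} *
        farLaplace T p α σ (interferenceIntensity lam w) ν s t := by
  have hR := h.measurable_nearestSq
  have hm1 : ∀ u, MeasurableSet {ω | u ≤ nearestSq X ω} := fun u =>
    measurableSet_le measurable_const hR
  have hm2 : MeasurableSet {ω | s ≤ nearestSq X ω ∧ nearestSq X ω < t} :=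
    (hm1 s).inter (measurableSet_lt hR measurable_const)
  have hsplit : {ω | s ≤ nearestSq X ω ∧ nearestSq X ω < t} =
      {ω | s ≤ nearestSq X ω} \ {ω | t ≤ nearestSq X ω} := by
    ext ω; simp
  have hsub : {ω | t ≤ nearestSq X ω} ⊆ {ω | s ≤ nearestSq X ω} := fun ω hω => hst.le.trans hω
  set c := threshold T p α s with hc
  set F : Ω → ℝ≥0∞ := fun ω => expNeg (c * farSum p X ξ g (pathLoss α) t ω) with hF
  have hFm : Measurable F := measurable_expNeg.comp
    ((h.measurable_farSum (measurable_pathLoss α) t).const_mul c)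
  have hvoid : ∀ u, 0 ≤ u → u ≤ t → ∫⁻ ω in {ω | u ≤ nearestSq X ω}, F ω ∂μ =
      μ {ω | u ≤ nearestSq X ω} * expNeg (ENNReal.ofReal
        (Real.pi * interferenceIntensity lam w) *
        ∫⁻ y in Ici t, (1 - laplaceTransform ν (c * pathLoss α y))) := by
    intro u hu hut
    rw [h.measure_le_nearestSq hw hu, ← h.laplace_void hw (measurable_pathLoss α) c hu
      (hs.trans_lt hst) hut, ← lintegral_indicator (hm1 u)]
    simp_rw [le_nearestSq_iff]
    rfl
  have hfin : ∫⁻ ω in {ω | t ≤ nearestSq X ω}, F ω ∂μ ≠ ∞ := by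
    rw [hvoid t (hs.trans hst.le) le_rfl]
    exact ENNReal.mul_ne_top (measure_ne_top _ _) (expNeg_ne_top _)
  have hdiff : ∫⁻ ω in {ω | s ≤ nearestSq X ω ∧ nearestSq X ω < t}, F ω ∂μ =
      μ {ω | s ≤ nearestSq X ω ∧ nearestSq X ω < t} * expNeg (ENNReal.ofReal
        (Real.pi * interferenceIntensity lam w) *
        ∫⁻ y in Ici t, (1 - laplaceTransform ν (c * pathLoss α y))) := by
    rw [hsplit, measure_sdiff hsub (hm1 t).nullMeasurableSet (measure_ne_top _ _),
      ENNReal.sub_mul (fun _ _ => expNeg_ne_top _), ← hvoid s hs hst.le,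
      ← hvoid t (hs.trans hst.le) le_rfl]
    refine ENNReal.eq_sub_of_add_eq hfin ?_
    rw [← lintegral_union (hm1 t) disjoint_sdiff_left, sdiff_union_of_subset hsub]
  simp_rw [mul_add, expNeg_add]
  rw [lintegral_const_mul _ hFm, hdiff, farLaplace, expNeg_add]
  ring

omit [IsProbabilityMeasure μ] [MeasurableSpace Ω] in
-- By local finiteness no BS lies strictly between `R` and `t n` once `n` is large, so the far sum
-- is eventually constant and only the weight still varies.
lemma tendsto_farSum_beyondSum (hT : 0 < T) (hp : 0 < p) (hα : 2 < α) {ω : Ω}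
    (hfin : ∀ m : ℕ, {i | ‖X i ω‖ ^ 2 < m}.Finite) (hpos : 0 < nearestSq X ω) {s t : ℕ → ℝ}
    (hrt : ∀ n, nearestSq X ω < t n)
    (hs : Tendsto s atTop (𝓝 (nearestSq X ω))) (ht : Tendsto t atTop (𝓝 (nearestSq X ω))) :
    Tendsto (fun n => expNeg (threshold T p α (s n) *
        (ENNReal.ofReal (σ ^ 2) + farSum p X ξ g (pathLoss α) (t n) ω))) atTop
      (𝓝 (expNeg (threshold T p α (nearestSq X ω) *
        (ENNReal.ofReal (σ ^ 2) + beyondSum p X ξ g (pathLoss α) ω)))) := by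
  obtain ⟨m, hm⟩ := exists_nat_gt (nearestSq X ω)
  have h1 : ∀ᶠ n in atTop, t n < m := ht.eventually (gt_mem_nhds hm)
  have h2 : ∀ᶠ n in atTop, ∀ i ∈ {i | ‖X i ω‖ ^ 2 < m},
      nearestSq X ω < ‖X i ω‖ ^ 2 → t n ≤ ‖X i ω‖ ^ 2 := by
    rw [(hfin m).eventually_all]
    intro i _
    by_cases hi : nearestSq X ω < ‖X i ω‖ ^ 2
    · exact (ht.eventually (gt_mem_nhds hi)).mono fun n hn _ => hn.le
    · exact Eventually.of_forall fun n hh => absurd hh hi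
  have h3 : ∀ᶠ n in atTop, farSum p X ξ g (pathLoss α) (t n) ω =
      beyondSum p X ξ g (pathLoss α) ω := by
    filter_upwards [h1, h2] with n hn1 hn2
    refine tsum_congr fun i => ?_
    have : t n ≤ ‖X i ω‖ ^ 2 ↔ nearestSq X ω < ‖X i ω‖ ^ 2 := by
      refine ⟨fun hh => (hrt n).trans_le hh, fun hh => ?_⟩
      by_cases hi : ‖X i ω‖ ^ 2 < m
      · exact hn2 i hi hh
      · exact hn1.le.trans (not_lt.1 hi)
    simp only [this]
  have h4 : Tendsto (fun n => expNeg (threshold T p α (s n) *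
        (ENNReal.ofReal (σ ^ 2) + beyondSum p X ξ g (pathLoss α) ω))) atTop
      (𝓝 (expNeg (threshold T p α (nearestSq X ω) *
        (ENNReal.ofReal (σ ^ 2) + beyondSum p X ξ g (pathLoss α) ω)))) :=
    -- The sum has not been shown finite here; positivity of the limiting threshold excludes the
    -- form `0 * ∞`.
    (continuous_expNeg.tendsto _).comp (ENNReal.Tendsto.mul_const
      (((continuous_threshold hα).tendsto _).comp hs) (Or.inl (threshold_pos hT hp hpos).ne'))
  exact h4.congr' (h3.mono fun n hn => by simp only [hn])

lemma lintegral_beyondSum [Fintype κ] [Countable ι] [Nonempty ι] [IsProbabilityMeasure ν]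
    (h : IsNetwork μ lam w p ν op X ξ g0 g) (hT : 0 < T) (hp : 0 < p) (hα : 2 < α)
    (hw : ∀ k, 0 ≤ w k ∧ w k ≤ 1) (hlam : 0 < associationIntensity lam)
    (hν_pos : ∀ᵐ x ∂ν, 0 < x) (hν_int : Integrable (fun x : ℝ => x ^ (2 / α)) ν) :
    ∫⁻ ω, expNeg (threshold T p α (nearestSq X ω) *
        (ENNReal.ofReal (σ ^ 2) + beyondSum p X ξ g (pathLoss α) ω)) ∂μ =
      ∫⁻ ω, farLaplace T p α σ (interferenceIntensity lam w) ν (nearestSq X ω)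
        (nearestSq X ω) ∂μ := by
  refine lintegral_eq_of_interval_factorization (K0 := fun r =>
      farLaplace T p α σ (interferenceIntensity lam w) ν r r)
    (Y := fun s t ω => expNeg (threshold T p α s *
        (ENNReal.ofReal (σ ^ 2) + farSum p X ξ g (pathLoss α) t ω)))
    h.measurable_nearestSq nearestSq_nonneg
    (fun s t => ?_) (fun _ _ _ => expNeg_le_one _) (fun _ _ => expNeg_le_one _)
    (fun s t hs hst => h.setLIntegral_farSum hw hs hst) ?_ ?_
  · exact measurable_expNeg.comp (((h.measurable_farSum (measurable_pathLoss α) t).const_add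
      _).const_mul _)
  · filter_upwards [h.ae_finite_near, h.ae_nearestSq_pos hw hlam] with ω h1 h2 s t _ hrt hs ht
    exact tendsto_farSum_beyondSum hT hp hα h1 h2 hrt hs ht
  · filter_upwards [h.ae_nearestSq_pos hw hlam] with ω h2 s t hs0 hsr hrt hs ht
    exact tendsto_farLaplace hT hp hα hν_pos hν_int h2 hs0 hsr hrt hs ht

end IsNetwork

/-! ### From the SINR event to a Laplace transform -/

lemma measurable_beyondSum {Ω ι : Type*} [MeasurableSpace Ω] [Countable ι] {p : ℝ}
    {X : ι → Ω → Plane} {ξ : ι → Ω → Bool} {g : ι → Ω → ℝ} {b : ℝ → ℝ≥0∞}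
    (hX : ∀ i, Measurable (X i)) (hξ : ∀ i, Measurable (ξ i)) (hg : ∀ i, Measurable (g i))
    (hb : Measurable b) : Measurable (beyondSum p X ξ g b) := by
  have hR : Measurable (nearestSq X) := Measurable.iInf fun i => by fun_prop
  refine Measurable.tsum fun i => Measurable.ite ?_ (by fun_prop) measurable_const
  exact (measurableSet_lt hR (show Measurable fun ω => ‖X i ω‖ ^ 2 by fun_prop)).inter
    (hξ i (measurableSet_singleton true))

lemma isNearest_iff {Ω ι : Type*} [Nonempty ι] {X : ι → Ω → Plane} {ω : Ω} {b : ι} :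
    IsNearest X ω b ↔ ‖X b ω‖ ^ 2 = nearestSq X ω := by
  have hle : ∀ i, ‖X b ω‖ ≤ ‖X i ω‖ ↔ ‖X b ω‖ ^ 2 ≤ ‖X i ω‖ ^ 2 := fun i =>
    (pow_le_pow_iff_left₀ (norm_nonneg _) (norm_nonneg _) two_ne_zero).symm
  simp only [IsNearest, hle]
  rw [← le_nearestSq_iff]
  exact ⟨fun h => le_antisymm h (le_nearestSq_iff.1 le_rfl b), fun h => h.le⟩

lemma norm_rpow_eq (x : Plane) (a : ℝ) : ‖x‖ ^ a = (‖x‖ ^ 2) ^ (a / 2) := by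
  rw [← Real.rpow_natCast_mul (norm_nonneg x)]
  congr 1
  push_cast
  ring

lemma interference_eq_beyondSum {Ω ι : Type*} {p α : ℝ}
    {X : ι → Ω → Plane} {ξ : ι → Ω → Bool} {g : ι → Ω → ℝ} {ω : Ω} {b : ι}
    (hb : ∀ i, i ≠ b ↔ nearestSq X ω < ‖X i ω‖ ^ 2) :
    interference p α X ξ g ω b = beyondSum p X ξ g (pathLoss α) ω := by
  refine tsum_congr fun i => ?_
  simp only [hb i, pathLoss]
  rw [norm_rpow_eq, ← ENNReal.ofReal_mul (by positivity)]
  congr 2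
  ring

/-- Multiply by `‖X b ω‖ ^ α / p`. The passage from quotient to product stays valid when noise plus
interference is `0` or `∞`, as `T > 0` and the numerator is finite. -/
lemma lt_sinr_iff {Ω ι : Type*} {T p α σ : ℝ} (hT : 0 < T) (hp : 0 < p)
    {X : ι → Ω → Plane} {ξ : ι → Ω → Bool} {g0 : Ω → ℝ} {g : ι → Ω → ℝ} {ω : Ω} {b : ι}
    (hb : 0 < ‖X b ω‖) :
    ENNReal.ofReal T < sinr p α σ X ξ g0 g ω b ↔
      threshold T p α (‖X b ω‖ ^ 2) * (ENNReal.ofReal (σ ^ 2) + interference p α X ξ g ω b) <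
        ENNReal.ofReal (g0 ω) := by
  have hk : 0 < ‖X b ω‖ ^ α / p := by positivity
  have hk0 : ENNReal.ofReal (‖X b ω‖ ^ α / p) ≠ 0 := (ENNReal.ofReal_pos.2 hk).ne'
  rw [sinr, ENNReal.lt_div_iff_mul_lt (Or.inr ENNReal.ofReal_ne_top)
    (Or.inr (ENNReal.ofReal_pos.2 hT).ne'),
    ← ENNReal.mul_lt_mul_iff_right hk0 ENNReal.ofReal_ne_top, ← mul_assoc,
    ← ENNReal.ofReal_mul hk.le, ← ENNReal.ofReal_mul hk.le, threshold, ← norm_rpow_eq, add_comm]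
  have e1 : ‖X b ω‖ ^ α / p * T = T / p * ‖X b ω‖ ^ α := by ring
  have e2 : ‖X b ω‖ ^ α / p * (g0 ω * ‖X b ω‖ ^ (-α) * p) = g0 ω := by
    rw [Real.rpow_neg hb.le]
    have : ‖X b ω‖ ^ α ≠ 0 := (Real.rpow_pos_of_pos hb α).ne'
    field_simp
  rw [e1, e2]

namespace IsNetwork

variable {Ω κ ι : Type*} [MeasurableSpace Ω] {μ : Measure Ω} [IsProbabilityMeasure μ]
  {lam : κ → ℝ≥0} {w : κ → ℝ} {T p α σ : ℝ} {ν : Measure ℝ}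
  {op : ι → κ} {X : ι → Ω → Plane} {ξ : ι → Ω → Bool} {g0 : Ω → ℝ} {g : ι → Ω → ℝ}

omit [IsProbabilityMeasure μ] in
lemma measure_lt_g0 (h : IsNetwork μ lam w p ν op X ξ g0 g) (hp : 0 < p) (c : ℝ≥0∞) :
    μ {ω | c < ENNReal.ofReal (g0 ω)} = expNeg c := by
  rcases eq_or_ne c ∞ with rfl | hc
  · simp [expNeg_top]
  · obtain ⟨y, hy, rfl⟩ : ∃ y : ℝ, 0 ≤ y ∧ c = ENNReal.ofReal y :=
      ⟨c.toReal, ENNReal.toReal_nonneg, (ENNReal.ofReal_toReal hc).symm⟩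
    have hg0 := h.measurable_g0
    have hpos : 0 < 1 / p := by positivity
    have := isProbabilityMeasure_expMeasure hpos
    have e : {ω | ENNReal.ofReal y < ENNReal.ofReal (g0 ω)} =
        (fun ω => p * g0 ω) ⁻¹' (Iic (p * y))ᶜ := by
      ext ω
      simp only [mem_ofPred_eq, mem_preimage, compl_Iic, mem_Ioi]
      rw [mul_lt_mul_iff_right₀ hp]
      exact ⟨fun hh => (ENNReal.ofReal_lt_ofReal_iff'.1 hh).1,
        fun hh => ENNReal.ofReal_lt_ofReal_iff'.2 ⟨hh, hy.trans_lt hh⟩⟩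
    rw [e, ← Measure.map_apply (by fun_prop) measurableSet_Iic.compl, h.rayleigh,
      prob_compl_eq_one_sub measurableSet_Iic, ← ofReal_measureReal, ← cdf_eq_real,
      cdf_expMeasure_eq hpos, if_pos (by positivity), ← ENNReal.ofReal_one,
      ← ENNReal.ofReal_sub _ (by
        rw [sub_nonneg, Real.exp_le_one_iff]; simp only [Left.neg_nonpos_iff]; positivity),
      sub_sub_cancel, expNeg_ofReal hy]
    congr 3
    field_simp

lemma measure_lt_gain [Countable ι] (h : IsNetwork μ lam w p ν op X ξ g0 g) (hp : 0 < p) :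
    μ {ω | threshold T p α (nearestSq X ω) *
        (ENNReal.ofReal (σ ^ 2) + beyondSum p X ξ g (pathLoss α) ω) < ENNReal.ofReal (g0 ω)} =
      ∫⁻ ω, expNeg (threshold T p α (nearestSq X ω) *
        (ENNReal.ofReal (σ ^ 2) + beyondSum p X ξ g (pathLoss α) ω)) ∂μ := by
  -- The threshold for `g0` as a function of positions and marks alone, obtained by taking the
  -- coordinate space itself as sample space. Since `g0` is independent of this pair, Fubini leaves
  -- the exponential tail at `H`.
  let H : (ι → Plane) × (ι → ℝ × Bool) → ℝ≥0∞ := fun z =>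
    threshold T p α (nearestSq (fun i (z : (ι → Plane) × (ι → ℝ × Bool)) => z.1 i) z) *
      (ENNReal.ofReal (σ ^ 2) + beyondSum p (fun i (z : (ι → Plane) × (ι → ℝ × Bool)) => z.1 i)
        (fun i z => (z.2 i).2) (fun i z => (z.2 i).1) (pathLoss α) z)
  have hH : Measurable H := by
    refine Measurable.mul ?_ ((measurable_beyondSum (fun i => by fun_prop) (fun i => by fun_prop)
      (fun i => by fun_prop) (measurable_pathLoss α)).const_add _)
    exact (measurable_threshold T p α).comp (Measurable.iInf fun i => by fun_prop)
  have hX := measurable_pi_iff.2 h.measurable_X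
  have hM : Measurable (fun ω i => (g i ω, ξ i ω)) :=
    measurable_pi_iff.2 fun i => (h.measurable_g i).prodMk (h.measurable_ξ i)
  have hind := IndepFun.prod_of_prod hX h.measurable_g0 hM h.indep_positions h.indep_g0
  have hS : MeasurableSet {q : ((ι → Plane) × (ι → ℝ × Bool)) × ℝ | H q.1 < ENNReal.ofReal q.2} :=
    measurableSet_lt (hH.comp measurable_fst) (by fun_prop)
  have e := lintegral_comp_of_indepFun hind (hX.prodMk hM) h.measurable_g0
    (measurable_one.indicator hS)
  have hU := (hX.prodMk hM).prodMk h.measurable_g0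
  have e1 : ∫⁻ ω, {q : ((ι → Plane) × (ι → ℝ × Bool)) × ℝ | H q.1 < ENNReal.ofReal q.2}.indicator
      (1 : ((ι → Plane) × (ι → ℝ × Bool)) × ℝ → ℝ≥0∞) ((fun i => X i ω, fun i => (g i ω, ξ i ω)), g0 ω) ∂μ =
      μ {ω | threshold T p α (nearestSq X ω) *
        (ENNReal.ofReal (σ ^ 2) + beyondSum p X ξ g (pathLoss α) ω) < ENNReal.ofReal (g0 ω)} :=
    lintegral_indicator_one (hU hS)
  have e2 : ∀ ω, ∫⁻ ω', {q : ((ι → Plane) × (ι → ℝ × Bool)) × ℝ |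
      H q.1 < ENNReal.ofReal q.2}.indicator
      (1 : ((ι → Plane) × (ι → ℝ × Bool)) × ℝ → ℝ≥0∞) ((fun i => X i ω, fun i => (g i ω, ξ i ω)), g0 ω') ∂μ =
      expNeg (threshold T p α (nearestSq X ω) *
        (ENNReal.ofReal (σ ^ 2) + beyondSum p X ξ g (pathLoss α) ω)) := fun ω => by
    rw [← h.measure_lt_g0 hp]
    exact lintegral_indicator_one ((measurable_const.prodMk h.measurable_g0) hS)
  rw [← e1, e]
  exact lintegral_congr e2

lemma measure_coverage [Fintype κ] [Countable ι] [Nonempty ι] [IsProbabilityMeasure ν]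
    (h : IsNetwork μ lam w p ν op X ξ g0 g) (hT : 0 < T) (hp : 0 < p)
    (hw : ∀ k, 0 ≤ w k ∧ w k ≤ 1) (hlam : 0 < associationIntensity lam) :
    μ {ω | ∃ b, IsNearest X ω b ∧ ENNReal.ofReal T < sinr p α σ X ξ g0 g ω b} =
      ∫⁻ ω, expNeg (threshold T p α (nearestSq X ω) *
        (ENNReal.ofReal (σ ^ 2) + beyondSum p X ξ g (pathLoss α) ω)) ∂μ := by
  rw [← h.measure_lt_gain hp]
  apply measure_congr
  filter_upwards [h.ae_finite_near, h.ae_nearestSq_pos hw hlam, h.ae_unique_nearest hw]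
    with ω hfin hpos huniq
  obtain ⟨b, hb⟩ := exists_eq_nearestSq hfin
  -- By uniqueness, excluding the server amounts to requiring a strictly larger distance, a
  -- condition that does not mention the random index `b`.
  have hne : ∀ i, i ≠ b ↔ nearestSq X ω < ‖X i ω‖ ^ 2 := by
    intro i
    have hle : nearestSq X ω ≤ ‖X i ω‖ ^ 2 := le_nearestSq_iff.1 le_rfl i
    refine ⟨fun hib => lt_of_le_of_ne hle fun hi => hib (huniq i b hi.symm hb), ?_⟩
    rintro hlt rfl
    exact hlt.ne' hb
  have hb0 : 0 < ‖X b ω‖ := by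
    rw [← hb] at hpos
    exact (norm_nonneg _).lt_of_ne fun hh => by simp [← hh] at hpos
  have key := lt_sinr_iff (α := α) (σ := σ) (ξ := ξ) (g0 := g0) (g := g) hT hp hb0
  rw [interference_eq_beyondSum hne, hb] at key
  refine propext ⟨?_, fun hh => ⟨b, isNearest_iff.2 hb, key.2 hh⟩⟩
  rintro ⟨b', hb', hlt⟩
  obtain rfl := huniq b' b (isNearest_iff.1 hb') hb
  exact key.1 hlt

end IsNetwork

/-! ### Integration over the nearest distance -/

lemma integral_expMeasure {r : ℝ} (hr : 0 < r) (f : ℝ → ℝ) :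
    ∫ z, f z ∂(expMeasure r) = r * ∫ z in Ioi 0, Real.exp (-(r * z)) * f z := by
  have h1 : expMeasure r = (volume : Measure ℝ).withDensity (exponentialPDF r) := rfl
  have hpdf : exponentialPDF r = fun z => ENNReal.ofReal (exponentialPDFReal r z) := rfl
  rw [h1, hpdf, integral_withDensity_eq_integral_toReal_smul
    (measurable_exponentialPDFReal r).ennreal_ofReal (Eventually.of_forall fun _ =>
      ENNReal.ofReal_lt_top), ← integral_const_mul, ← integral_Ici_eq_integral_Ioi,
    ← integral_indicator measurableSet_Ici]
  refine integral_congr_ae (Eventually.of_forall fun z => ?_)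
  simp only [smul_eq_mul, ENNReal.toReal_ofReal (exponentialPDFReal_nonneg hr z)]
  by_cases hz : 0 ≤ z
  · rw [indicator_of_mem (by exact hz)]
    simp [exponentialPDFReal, gammaPDFReal, hz, mul_assoc]
  · rw [indicator_of_notMem (by exact hz)]
    simp [exponentialPDFReal, gammaPDFReal, hz]

end

theorem proposition1 {Ω κ ι : Type*} [MeasurableSpace Ω] [Fintype κ] [Countable ι]
    (μ : Measure Ω) [IsProbabilityMeasure μ]
    (lam : κ → ℝ≥0) (w : κ → ℝ) (T p α σ : ℝ) (ν : Measure ℝ)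
    (op : ι → κ) (X : ι → Ω → Plane) (ξ : ι → Ω → Bool) (g0 : Ω → ℝ) (g : ι → Ω → ℝ)
    (hT : 0 < T) (hp : 0 < p) (hα : 2 < α)
    (hw : ∀ k, 0 ≤ w k ∧ w k ≤ 1)
    (hlam : 0 < associationIntensity lam)
    (hν_pos : ∀ᵐ x ∂ν, 0 < x)
    (hν_int : Integrable (fun x : ℝ => x ^ (2 / α)) ν)
    (hnet : IsNetwork μ lam w p ν op X ξ g0 g) :
    Integrable (betaIntegrand T p α) ν ∧
    IntegrableOn (fun z : ℝ => Real.exp (-(coeffA (associationIntensity lam)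
        (interferenceIntensity lam w) (betaCoeff T p α ν) * z + coeffB T p σ * z ^ (α / 2))))
      (Ioi 0) volume ∧
    coverageProbability μ T p α σ X ξ g0 g =
      Real.pi * associationIntensity lam *
        ∫ z in Ioi (0 : ℝ), Real.exp (-(coeffA (associationIntensity lam)
          (interferenceIntensity lam w) (betaCoeff T p α ν) * z + coeffB T p σ * z ^ (α / 2))) := by
  have hι : Nonempty ι := hnet.nonempty_of_intensity hlam
  have hν : IsProbabilityMeasure ν := by
    obtain ⟨i⟩ := hι
    rw [← hnet.gain_law i]
    exact Measure.isProbabilityMeasure_map ((hnet.measurable_g i).const_mul p).aemeasurable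
  have hlamI : 0 ≤ interferenceIntensity lam w :=
    Finset.sum_nonneg fun k _ => mul_nonneg (hw k).1 (lam k).coe_nonneg
  have hβ := one_le_betaCoeff hT hp hα hν_pos hν_int
  have hpos : 0 < Real.pi * associationIntensity lam := mul_pos Real.pi_pos hlam
  refine ⟨integrable_betaIntegrand hT hp hα hν_pos hν_int, ?_, ?_⟩
  · have hB : 0 ≤ coeffB T p σ := by unfold coeffB; positivity
    have hA : 0 < coeffA (associationIntensity lam) (interferenceIntensity lam w)
        (betaCoeff T p α ν) := by
      have : 0 ≤ interferenceIntensity lam w * (betaCoeff T p α ν - 1) :=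
        mul_nonneg hlamI (by linarith)
      exact mul_pos Real.pi_pos (by linarith)
    -- As `β ≥ 1`, the coefficient `A` is at least `π λ_A > 0`, so `exp (-A z)` dominates even
    -- without noise.
    refine (exp_neg_integrableOn_Ioi 0 hA).mono' (by fun_prop) ?_
    refine (ae_restrict_iff' measurableSet_Ioi).2 (Eventually.of_forall fun z (hz : 0 < z) => ?_)
    rw [Real.norm_of_nonneg (Real.exp_pos _).le, Real.exp_le_exp]
    have : 0 ≤ coeffB T p σ * z ^ (α / 2) := by positivity
    linarith
  · set k : ℝ → ℝ := fun r => Real.exp (-(coeffB T p σ * r ^ (α / 2) +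
      Real.pi * interferenceIntensity lam w * (betaCoeff T p α ν - 1) * r)) with hk
    have hkm : Measurable k := by fun_prop
    have h1 : μ {ω | ∃ b, IsNearest X ω b ∧ ENNReal.ofReal T < sinr p α σ X ξ g0 g ω b} =
        ∫⁻ ω, ENNReal.ofReal (k (nearestSq X ω)) ∂μ := by
      rw [hnet.measure_coverage hT hp hw hlam,
        hnet.lintegral_beyondSum hT hp hα hw hlam hν_pos hν_int]
      refine lintegral_congr_ae ?_
      filter_upwards [hnet.ae_nearestSq_pos hw hlam] with ω hω
      exact farLaplace_self hT hp hα hlamI hν_pos hν_int hω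
    have hkR : Measurable fun ω => k (nearestSq X ω) := hkm.comp hnet.measurable_nearestSq
    rw [coverageProbability, measureReal_def, h1,
      ← integral_eq_lintegral_of_nonneg_ae (Eventually.of_forall fun ω => (Real.exp_pos _).le)
        hkR.aestronglyMeasurable,
      ← integral_map (φ := nearestSq X) hnet.measurable_nearestSq.aemeasurable
        hkm.aestronglyMeasurable, hnet.map_nearestSq hw hlam, integral_expMeasure hpos]
    -- The density contributes `π λ_A z` to the exponent and the interference `π λ_I (β - 1) z`;
    -- together they make `A z`.
    congr 1
    refine setIntegral_congr_fun measurableSet_Ioi fun z _ => ?_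
    simp only [hk, coeffA]
    rw [← Real.exp_add]
    congr 1
    ring
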